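/- Let $\mathcal A=\{1,\dots,K\}$ and let $\mathcal X$ be a measurable context space (for instance a subset of $\mathbb R^{d}$). A contextual bandit experiment is run at times $t=1,2,\dots$: the pairs $(X_t,\{Y_t(a)\}_{a\in\mathcal A})$ of a context and real potential outcomes are i.i.d. with a law $\mathcal P$, and for each $t$ the pair is independent of the past history $\mathcal H_{t-1}=\{X_\tau,\pi_\tau,A_\tau,Y_\tau\}_{\tau<t}$; the action $A_t$ is drawn with conditional probabilities $P(A_t=a\mid \mathcal H_{t-1},X_t)=\pi_t(a\mid X_t,\mathcal H_{t-1})$ given by a behavior policy $\pi$; the outcome $Y_t=Y_t(A_t)$ is observed and $\pi_t:=\pi_t(A_t\mid X_t,\mathcal H_{t-1})$ is recorded. Let $\pi^e(\cdot\mid x)$ be a target policy, and put $V^*=\mathbb E_X\,\mathbb E_{A\sim\pi^e(\cdot|X)}[Y(A)]=\mathbb E\big[\sum_a\pi^e(a|X)Y(a)\big]$ and $\theta_a^*=\mathbb E[\pi^e(a|X)Y(a)]$, where $(X,Y(\cdot))\sim\mathcal P$. Assume (i) unconfoundedness: $A_t\perp\{Y_t(a)\}_{a\in\mathcal A}\mid(\mathcal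 H_{t-1},X_t)$ for all $t$; (ii) $\mathbb E[Y_t^4]<\infty$ for all $t$; (iii) policy convergence: there is a stationary policy $\bar\pi(\cdot\mid x)$ such that $\pi_t(a\mid X_t,\mathcal H_{t-1})-\bar\pi(a\mid X_t)\to0$ in probability as $t\to\infty$, for every $a\in\mathcal A$; (iv) minimum sampling probability: for every $a\in\mathcal A$ there is a constant $\pi_{\min}\in(0,1)$ such that, for all $t$, $\pi_t(a\mid X_t,\mathcal H_{t-1})\ge\pi_{\min}$ almost surely. Define $$\hat G_{a,T}=\frac1T\sum_{t=1}^T\frac{1_{\{A_t=a\}}}{\pi_t},\qquad \hat\theta_a^{(T)}=\hat G_{a,T}^{-1}\,\frac1T\sum_{t=1}^T\frac{1_{\{A_t=a\}}}{\pi_t}\,\pi^e(a|X_t)Y_t,\qquad \hat V^{(T)}=\sum_{a\in\mathcal A}\hat\theta_a^{(T)},$$ $$\hat I_{a,T}=\frac1T\sum_{t=1}^T\frac{1_{\{A_t=a\}}}{\pi_t^2}\big(\pi^e(a|X_t)Y_t-\hat\theta_a^{(T)}\big)^2,$$ with the convention $0^{-1}=0$. Then the expectations defining $V^*$, $\theta_a^*$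 and $$\sigma^2:=\sum_{a\in\mathcal A}\mathbb E\left[\frac{(\pi^e(a|X)Y(a)-\theta_a^*)^2}{\bar\pi(a|X)}\right]$$ are finite, with $\bar\pi(a|X)>0$ almost surely for every $a$, and as $T\to\infty$ $$\sqrt T\,\big(\hat V^{(T)}-V^*\big)\xrightarrow{d}\mathcal N(0,\sigma^2),\qquad \sum_{a\in\mathcal A}\hat G_{a,T}^{-2}\,\hat I_{a,T}\xrightarrow{p}\sigma^2 .$$ -/

import Mathlib

open MeasureTheory ProbabilityTheory Filter Topology

noncomputable section

namespace OffPolicy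

/-- A (measurable) stochastic policy: to each state `s` it assigns a probability vector on the
actions `Fin K`. With `S` the context space this is a stationary policy. -/
structure StochasticPolicy (S : Type*) [MeasurableSpace S] (K : ℕ) where
  prob : S → Fin K → ℝ
  nonneg : ∀ s a, 0 ≤ prob s a
  sum_eq_one : ∀ s, ∑ a, prob s a = 1
  measurable : ∀ a, Measurable fun s => prob s a

/-- Histories of length `t`: one record (context, recorded selection probability, action, observed
outcome) for each time `τ < t`. Times are numbered `0, 1, 2, …`. -/
abbrev History (𝒳 : Type*) (K t : ℕ) : Type _ := Fin t → 𝒳 × ℝ × Fin K × ℝ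

/-- A behavior policy: at each time, a stochastic policy depending on the past history and on the
current context. -/
abbrev BehaviorPolicy (𝒳 : Type*) [MeasurableSpace 𝒳] (K : ℕ) : Type _ :=
  (t : ℕ) → StochasticPolicy (History 𝒳 K t × 𝒳) K

/-- The random variables of a contextual bandit experiment. -/
structure BanditData (Ω 𝒳 : Type*) (K : ℕ) where
  /-- context `X t` -/
  X : ℕ → Ω → 𝒳
  /-- potential outcomes `Y t a` -/
  Y : ℕ → Fin K → Ω → ℝ
  /-- selected action `A t` -/
  A : ℕ → Ω → Fin K
  /-- recorded probability `p t` of the selected action -/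
  p : ℕ → Ω → ℝ

section Data

variable {Ω 𝒳 : Type*} {K : ℕ}

/-- The observed outcome: the potential outcome of the selected action. -/
def BanditData.Yobs (D : BanditData Ω 𝒳 K) (t : ℕ) (ω : Ω) : ℝ := D.Y t (D.A t ω) ω

/-- Context and all potential outcomes at time `t`. -/
def BanditData.env (D : BanditData Ω 𝒳 K) (t : ℕ) (ω : Ω) : 𝒳 × (Fin K → ℝ) :=
  (D.X t ω, fun a => D.Y t a ω)

/-- The history before time `t`. -/
def BanditData.hist (D : BanditData Ω 𝒳 K) (t : ℕ) (ω : Ω) : History 𝒳 K t :=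
  fun τ => (D.X τ ω, D.p τ ω, D.A τ ω, D.Yobs τ ω)

/-- History before time `t` together with the context at time `t`. -/
def BanditData.histX (D : BanditData Ω 𝒳 K) (t : ℕ) (ω : Ω) : History 𝒳 K t × 𝒳 :=
  (D.hist t ω, D.X t ω)

/-- The σ-algebra generated by the history before time `t` and the context at time `t`. -/
abbrev BanditData.sigmaHistX [MeasurableSpace 𝒳] (D : BanditData Ω 𝒳 K) (t : ℕ) :
    MeasurableSpace Ω :=
  MeasurableSpace.comap (D.histX t) inferInstance

end Data

section Model

variable {Ω 𝒳 : Type*} [MeasurableSpace Ω] [MeasurableSpace 𝒳] {K : ℕ}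

/-- The data `D` come from a stochastic contextual bandit environment with law `ν` of
(context, potential outcomes), in which actions are selected by the behavior policy `π`. -/
structure IsBanditExperiment (P : Measure Ω) (ν : Measure (𝒳 × (Fin K → ℝ)))
    (π : BehaviorPolicy 𝒳 K) (D : BanditData Ω 𝒳 K) : Prop where
  measurable_X : ∀ t, Measurable (D.X t)
  measurable_Y : ∀ t a, Measurable (D.Y t a)
  measurable_A : ∀ t, Measurable (D.A t)
  /-- contexts and potential outcomes have law `ν` at each time … -/
  hasLaw : ∀ t, HasLaw (D.env t) ν P
  /-- … are independent over time … -/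
  iIndep : iIndepFun D.env P
  /-- … and are drawn afresh by the environment, independently of the past history. -/
  fresh : ∀ t, IndepFun (D.env t) (D.hist t) P
  /-- given history and context, the action is drawn from the behavior policy -/
  selection : ∀ t a, P⟦D.A t ⁻¹' {a} | D.sigmaHistX t⟧ =ᵐ[P] fun ω => (π t).prob (D.histX t ω) a
  /-- the recorded probability is that of the selected action -/
  recorded : ∀ t ω, D.p t ω = (π t).prob (D.histX t ω) (D.A t ω)

/-- Conditional independence of the random variables `f` and `g` given the σ-algebra `m`, by the
product formula for conditional probabilities (no topological condition on `Ω`). -/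
def CondIndepGiven {β γ : Type*} [MeasurableSpace β] [MeasurableSpace γ] (P : Measure Ω)
    (m : MeasurableSpace Ω) (f : Ω → β) (g : Ω → γ) : Prop :=
  ∀ (s : Set β) (u : Set γ), MeasurableSet s → MeasurableSet u →
    P⟦f ⁻¹' s ∩ g ⁻¹' u | m⟧ =ᵐ[P] P⟦f ⁻¹' s | m⟧ * P⟦g ⁻¹' u | m⟧

/-- Unconfoundedness: given history and context, the action is conditionally independent of the
vector of potential outcomes. -/
def Unconfounded (P : Measure Ω) (D : BanditData Ω 𝒳 K) : Prop :=
  ∀ t, CondIndepGiven P (D.sigmaHistX t) (D.A t) (fun ω a => D.Y t a ω)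

/-- Minimum sampling probability at action `a`. -/
def MinSampling (P : Measure Ω) (π : BehaviorPolicy 𝒳 K) (D : BanditData Ω 𝒳 K) (a : Fin K) :
    Prop :=
  ∃ πmin ∈ Set.Ioo (0 : ℝ) 1, ∀ t, ∀ᵐ ω ∂P, πmin ≤ (π t).prob (D.histX t ω) a

/-- Convergence of the behavior policy to the stationary policy `πbar`, at every action: the
selection probabilities at the observed history and context merge in probability. -/
def PolicyConverges (P : Measure Ω) (π : BehaviorPolicy 𝒳 K) (D : BanditData Ω 𝒳 K)
    (πbar : StochasticPolicy 𝒳 K) : Prop :=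
  ∀ a, TendstoInMeasure P
    (fun t ω => (π t).prob (D.histX t ω) a - πbar.prob (D.X t ω) a) atTop (fun _ => 0)

end Model

section Targets

variable {𝒳 : Type*} [MeasurableSpace 𝒳] {K : ℕ}

/-- The value of the target policy: draw `(X, Y(·))` from `ν`, then an action from `πe(·|X)`
independently of the potential outcomes, and take the expected outcome. -/
def policyValue (ν : Measure (𝒳 × (Fin K → ℝ))) (πe : StochasticPolicy 𝒳 K) : ℝ :=
  ∫ z, ∑ a, πe.prob z.1 a * z.2 a ∂ν

/-- The arm parameter `E[πe(a|X) Y(a)]`. -/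
def armTarget (ν : Measure (𝒳 × (Fin K → ℝ))) (πe : StochasticPolicy 𝒳 K) (a : Fin K) : ℝ :=
  ∫ z, πe.prob z.1 a * z.2 a ∂ν

/-- The integrand of the `a`-th term of the asymptotic variance. -/
def armVarIntegrand (ν : Measure (𝒳 × (Fin K → ℝ))) (πe πbar : StochasticPolicy 𝒳 K)
    (a : Fin K) (z : 𝒳 × (Fin K → ℝ)) : ℝ :=
  (πe.prob z.1 a * z.2 a - armTarget ν πe a) ^ 2 / πbar.prob z.1 a

/-- The asymptotic variance `∑ₐ E[(πe(a|X) Y(a) - θₐ)² / πbar(a|X)]`. -/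
def asympVar (ν : Measure (𝒳 × (Fin K → ℝ))) (πe πbar : StochasticPolicy 𝒳 K) : ℝ :=
  ∑ a, ∫ z, armVarIntegrand ν πe πbar a z ∂ν

end Targets

section Estimators

variable {Ω 𝒳 : Type*} [MeasurableSpace 𝒳] {K : ℕ}

/-- The average inverse probability weight of action `a` over the first `T` times. -/
def weightMean (D : BanditData Ω 𝒳 K) (T : ℕ) (a : Fin K) (ω : Ω) : ℝ :=
  (1 / (T : ℝ)) * ∑ t ∈ Finset.range T, (if D.A t ω = a then 1 else 0) / D.p t ω

/-- The self-normalized inverse probability weighted estimator of the arm parameter. -/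
def armEstimator (πe : StochasticPolicy 𝒳 K) (D : BanditData Ω 𝒳 K) (T : ℕ) (a : Fin K) (ω : Ω) :
    ℝ :=
  (weightMean D T a ω)⁻¹ *
    ((1 / (T : ℝ)) * ∑ t ∈ Finset.range T,
      (if D.A t ω = a then 1 else 0) / D.p t ω * (πe.prob (D.X t ω) a * D.Yobs t ω))

/-- The estimator of the policy value. -/
def valueEstimator (πe : StochasticPolicy 𝒳 K) (D : BanditData Ω 𝒳 K) (T : ℕ) (ω : Ω) : ℝ :=
  ∑ a, armEstimator πe D T a ω

/-- The weighted mean of squared residuals of arm `a`. -/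
def residualMean (πe : StochasticPolicy 𝒳 K) (D : BanditData Ω 𝒳 K) (T : ℕ) (a : Fin K) (ω : Ω) :
    ℝ :=
  (1 / (T : ℝ)) * ∑ t ∈ Finset.range T,
    (if D.A t ω = a then 1 else 0) / D.p t ω ^ 2 *
      (πe.prob (D.X t ω) a * D.Yobs t ω - armEstimator πe D T a ω) ^ 2

/-- The variance estimator. -/
def varEstimator (πe : StochasticPolicy 𝒳 K) (D : BanditData Ω 𝒳 K) (T : ℕ) (ω : Ω) : ℝ :=
  ∑ a, ((weightMean D T a ω) ^ 2)⁻¹ * residualMean πe D T a ω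

end Estimators

end OffPolicy

end

/-! Up to an event of vanishing probability, $\sqrt T(\hat\theta_a-\theta_a^*)=\hat
G_a^{-1}\,T^{-1/2}\sum_t \frac{1_{\{A_t=a\}}}{\pi_t}(\pi^e(a|X_t)Y_t-\theta_a^*)$. Unconfoundedness
makes the selection of an arm a change of density by $\pi_t(a)$ (`map_restrict_selection`), which
cancels one inverse weight. Hence the summands are exactly centered given the past, and their second
moments given the past involve $1/\pi_t(a)$. Because $\pi_t$ is bounded below and merges with
$\bar\pi$, this factor may be replaced by $1/\bar\pi(a|X_t)$ with an $L^1$ error tending to $0$, and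
the fresh pair of context and outcomes then decouples from the history
(`norm_integral_weightedObs_smul_sub_le`).

Two consequences carry the proof. Weighted observations are asymptotically uncorrelated, so their
averages obey a weak law (`tendstoInMeasure_average_weightedObs`); this gives $\hat G_a\to1$ and the
consistency of both estimators. The increments summed over arms satisfy a martingale central limit
theorem (`tendstoInDistribution_inv_sqrt_mul_sum_of_orthogonal`), proved by a recursion for
characteristic functions in which the past enters only through its characters $e^{isS}$. Two arms
are never selected at once, so the variance is a sum over arms. Slutsky's lemma concludes. -/

/-! ### Convergence in measure and convergence of expectations. -/

section ConvergenceInMeasure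

variable {Ω ι E F : Type*} [MeasurableSpace Ω] {P : Measure Ω} {l : Filter ι}

/-- Continuous mapping for convergence in measure to a constant. -/
lemma tendstoInMeasure_comp_continuousAt [PseudoMetricSpace E] [PseudoMetricSpace F]
    {X : ι → Ω → E} {c : E} {g : E → F} (hX : TendstoInMeasure P X l fun _ => c)
    (hg : ContinuousAt g c) :
    TendstoInMeasure P (fun i ω => g (X i ω)) l fun _ => g c := by
  rw [tendstoInMeasure_iff_dist] at hX ⊢
  intro ε hε
  obtain ⟨δ, hδ, h⟩ := Metric.continuousAt_iff.1 hg ε hε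
  refine tendsto_of_tendsto_of_tendsto_of_le_of_le tendsto_const_nhds (hX δ hδ)
    (fun _ => zero_le) fun i => measure_mono fun ω hω => ?_
  by_contra hc
  exact absurd (h (not_le.1 hc)) (not_lt.2 hω)

lemma tendstoInMeasure_prodMk_const [PseudoMetricSpace E] [PseudoMetricSpace F]
    {X : ι → Ω → E} {Y : ι → Ω → F} {c : E} {d : F} (hX : TendstoInMeasure P X l fun _ => c)
    (hY : TendstoInMeasure P Y l fun _ => d) :
    TendstoInMeasure P (fun i ω => (X i ω, Y i ω)) l fun _ => (c, d) := by
  rw [tendstoInMeasure_iff_dist] at hX hY ⊢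
  intro ε hε
  refine tendsto_of_tendsto_of_tendsto_of_le_of_le tendsto_const_nhds
    (by simpa using (hX ε hε).add (hY ε hε)) (fun _ => zero_le) fun i =>
      (measure_mono fun ω hω => ?_).trans (measure_union_le _ _)
  simpa [Prod.dist_eq] using hω

lemma tendstoInMeasure_add_const {X Y : ι → Ω → ℝ} {c d : ℝ}
    (hX : TendstoInMeasure P X l fun _ => c) (hY : TendstoInMeasure P Y l fun _ => d) :
    TendstoInMeasure P (fun i ω => X i ω + Y i ω) l fun _ => c + d := by
  have h : ContinuousAt (fun z : ℝ × ℝ => z.1 + z.2) (c, d) :=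
    continuous_add.continuousAt
  have hXY := tendstoInMeasure_prodMk_const hX hY
  have hg := tendstoInMeasure_comp_continuousAt hXY h
  simpa using hg

lemma tendstoInMeasure_mul_const {X Y : ι → Ω → ℝ} {c d : ℝ}
    (hX : TendstoInMeasure P X l fun _ => c) (hY : TendstoInMeasure P Y l fun _ => d) :
    TendstoInMeasure P (fun i ω => X i ω * Y i ω) l fun _ => c * d := by
  have h : ContinuousAt (fun z : ℝ × ℝ => z.1 * z.2) (c, d) :=
    continuous_mul.continuousAt
  have hXY := tendstoInMeasure_prodMk_const hX hY
  have hg := tendstoInMeasure_comp_continuousAt hXY h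
  simpa using hg

lemma tendstoInMeasure_const [PseudoMetricSpace E] (c : E) :
    TendstoInMeasure P (fun (_ : ι) (_ : Ω) => c) l fun _ => c := by
  rw [tendstoInMeasure_iff_dist]
  intro ε hε
  simp [not_le.2 hε, tendsto_const_nhds]

lemma tendstoInMeasure_finsetSum_const {κ : Type*} (s : Finset κ) {X : κ → ι → Ω → ℝ} {c : κ → ℝ}
    (hX : ∀ k ∈ s, TendstoInMeasure P (X k) l fun _ => c k) :
    TendstoInMeasure P (fun i ω => ∑ k ∈ s, X k i ω) l fun _ => ∑ k ∈ s, c k := by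
  classical
  induction s using Finset.induction_on with
  | empty => simpa using tendstoInMeasure_const (0 : ℝ)
  | insert k s hk ih =>
    simp only [Finset.sum_insert hk]
    exact tendstoInMeasure_add_const (hX k (by simp)) (ih fun j hj => hX j (by simp [hj]))

/-- Chebyshev's inequality. -/
lemma measureReal_le_abs_le_integral_sq_div [IsFiniteMeasure P] {X : Ω → ℝ}
    (hX : Integrable (fun ω => X ω ^ 2) P) {ε : ℝ} (hε : 0 < ε) :
    P.real {ω | ε ≤ |X ω|} ≤ (∫ ω, X ω ^ 2 ∂P) / ε ^ 2 := by
  rw [le_div_iff₀ (by positivity), mul_comm]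
  refine le_trans ?_ (mul_meas_ge_le_integral_of_nonneg (Eventually.of_forall fun ω => sq_nonneg _)
    hX (ε ^ 2))
  refine mul_le_mul_of_nonneg_left (measureReal_mono fun ω hω => ?_) (sq_nonneg _)
  simp only [Set.mem_ofPred_eq] at hω ⊢
  rw [← sq_abs (X ω)]
  gcongr

lemma tendstoInMeasure_of_tendsto_integral_sq [IsFiniteMeasure P] {X : ι → Ω → ℝ} {c : ℝ}
    (hX : ∀ i, Integrable (fun ω => (X i ω - c) ^ 2) P)
    (h : Tendsto (fun i => ∫ ω, (X i ω - c) ^ 2 ∂P) l (𝓝 0)) :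
    TendstoInMeasure P X l fun _ => c := by
  rw [tendstoInMeasure_iff_measureReal_dist]
  intro ε hε
  refine squeeze_zero (fun _ => measureReal_nonneg)
    (fun i => measureReal_le_abs_le_integral_sq_div (hX i) hε) ?_
  simpa using h.div_const (ε ^ 2)

/-- The product of a sequence tending to `0` in measure and a sequence bounded in `L²` tends to `0`
in measure. -/
lemma tendstoInMeasure_mul_of_integral_sq_le [IsFiniteMeasure P] {X Y : ι → Ω → ℝ} {C : ℝ}
    (hX : TendstoInMeasure P X l fun _ => 0) (hY : ∀ i, Integrable (fun ω => Y i ω ^ 2) P)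
    (hC : ∀ i, ∫ ω, Y i ω ^ 2 ∂P ≤ C) :
    TendstoInMeasure P (fun i ω => X i ω * Y i ω) l fun _ => 0 := by
  rw [tendstoInMeasure_iff_measureReal_dist] at hX ⊢
  intro ε hε
  simp only [dist_zero_right, Real.norm_eq_abs] at hX ⊢
  -- If the product is at least `ε`, then `X` is at least `η` or `Y` is at least `ε / η` in absolute
  -- value; Chebyshev handles the second event. The index goes to the limit before `η` tends to `0`.
  have key : ∀ η > 0, ∀ i, P.real {ω | ε ≤ |X i ω * Y i ω|} ≤
      P.real {ω | η ≤ |X i ω|} + |C| * η ^ 2 / ε ^ 2 := by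
    intro η hη i
    have h1 := measureReal_le_abs_le_integral_sq_div (hY i) (div_pos hε hη)
    have h2 : P.real {ω | ε ≤ |X i ω * Y i ω|} ≤
        P.real {ω | η ≤ |X i ω|} + P.real {ω | ε / η ≤ |Y i ω|} := by
      refine (measureReal_mono (fun ω hω => ?_)).trans (measureReal_union_le _ _)
      by_contra hc
      simp only [Set.mem_union, Set.mem_ofPred_eq, not_or, not_le, abs_mul] at hc hω
      have : |X i ω| * |Y i ω| < η * (ε / η) :=
        mul_lt_mul'' hc.1 hc.2 (abs_nonneg _) (abs_nonneg _)
      rw [mul_div_cancel₀ _ hη.ne'] at this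
      linarith
    have h3 : (∫ ω, Y i ω ^ 2 ∂P) / (ε / η) ^ 2 ≤ |C| * η ^ 2 / ε ^ 2 := by
      rw [div_pow, div_div_eq_mul_div]
      gcongr
      exact (hC i).trans (le_abs_self _)
    linarith
  rw [Metric.tendsto_nhds]
  intro r hr
  have hlim : Tendsto (fun η : ℝ => |C| * η ^ 2 / ε ^ 2) (𝓝[>] 0) (𝓝 0) := by
    have : ContinuousAt (fun η : ℝ => |C| * η ^ 2 / ε ^ 2) 0 := by fun_prop
    simpa using this.tendsto.mono_left nhdsWithin_le_nhds
  obtain ⟨η, h1, hη⟩ := ((hlim.eventually_lt_const (half_pos hr)).and self_mem_nhdsWithin).exists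
  filter_upwards [(hX η hη).eventually_lt_const (half_pos hr)] with i hi
  rw [dist_zero_right, Real.norm_of_nonneg measureReal_nonneg]
  linarith [key η hη i]

/-- Bounded convergence: the integrand is at most `r / 2` off the event where it exceeds `r / 2`,
and at most `B` on that event, whose probability vanishes. -/
lemma tendsto_integral_abs_of_tendstoInMeasure [IsProbabilityMeasure P] {W : ι → Ω → ℝ} {B : ℝ}
    (hWm : ∀ i, AEMeasurable (W i) P) (hWB : ∀ i, ∀ᵐ ω ∂P, |W i ω| ≤ B)
    (hW : TendstoInMeasure P W l fun _ => 0) :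
    Tendsto (fun i => ∫ ω, |W i ω| ∂P) l (𝓝 0) := by
  rw [tendstoInMeasure_iff_measureReal_dist] at hW
  simp only [dist_zero_right, Real.norm_eq_abs] at hW
  rw [Metric.tendsto_nhds]
  intro r hr
  have h0 := (hW (r / 2) (half_pos hr)).const_mul |B|
  rw [mul_zero] at h0
  filter_upwards [h0.eventually_lt_const (half_pos hr)] with i hi
  rw [dist_zero_right, Real.norm_of_nonneg (integral_nonneg fun _ => abs_nonneg _)]
  have hs : NullMeasurableSet {ω | r / 2 ≤ |W i ω|} P :=
    nullMeasurableSet_le aemeasurable_const (by have := hWm i; fun_prop)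
  have hint : Integrable ({ω | r / 2 ≤ |W i ω|}.indicator fun _ => |B|) P :=
    (integrable_const _).indicator₀ hs
  have : ∫ ω, |W i ω| ∂P ≤ ∫ ω, (r / 2 + {ω | r / 2 ≤ |W i ω|}.indicator (fun _ => |B|) ω) ∂P := by
    refine integral_mono_of_nonneg (Eventually.of_forall fun _ => abs_nonneg _)
      ((integrable_const _).add hint) ?_
    filter_upwards [hWB i] with ω hω
    by_cases h : r / 2 ≤ |W i ω|
    · rw [Set.indicator_of_mem (s := {ω | r / 2 ≤ |W i ω|}) h]
      linarith [le_abs_self B]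
    · rw [Set.indicator_of_notMem (s := {ω | r / 2 ≤ |W i ω|}) h]
      linarith
  rw [integral_add (integrable_const _) hint, integral_indicator₀ hs] at this
  simp only [integral_const, smul_eq_mul, probReal_univ, one_mul, measureReal_restrict_apply_univ]
    at this
  linarith

/-- If the `X i` all have the law `ν`, then weights which are bounded and tend to `0` in measure
make the expectation of a fixed `ν`-integrable function of `X i` tend to `0`. -/
lemma tendsto_integral_mul_of_tendstoInMeasure [IsProbabilityMeasure P] [MeasurableSpace E]
    {ν : Measure E} {X : ι → Ω → E} (hX : ∀ i, HasLaw (X i) ν P) {H : E → ℝ}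
    (hH : Integrable H ν) {W : ι → Ω → ℝ} {B : ℝ} (hWm : ∀ i, AEMeasurable (W i) P)
    (hWB : ∀ i, ∀ᵐ ω ∂P, |W i ω| ≤ B) (hW : TendstoInMeasure P W l fun _ => 0) :
    Tendsto (fun i => ∫ ω, |H (X i ω)| * |W i ω| ∂P) l (𝓝 0) := by
  have hW1 := tendsto_integral_abs_of_tendstoInMeasure hWm hWB hW
  -- `R M` is the part of `|H|` above the level `M`. Then $|H||W|\le M|W|+|B|R_M$, where the mean of
  -- $R_M(X_i)$ depends only on `ν` and is small for large `M`. So `M` can be fixed first, uniformly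
  -- in `i`.
  let R : ℕ → E → ℝ := fun M z => |H z| - min |H z| M
  have hR0 : ∀ M z, 0 ≤ R M z := fun M z => sub_nonneg.2 (min_le_left _ _)
  have hRm : ∀ M, AEStronglyMeasurable (R M) ν := fun M =>
    hH.abs.1.sub (hH.abs.1.inf aestronglyMeasurable_const)
  have hRle : ∀ M z, R M z ≤ |H z| := fun M z =>
    sub_le_self _ (le_min (abs_nonneg _) (Nat.cast_nonneg _))
  have hRi : ∀ M, Integrable (R M) ν := fun M => hH.abs.mono' (hRm M)
    (Eventually.of_forall fun z => by
      rw [Real.norm_of_nonneg (hR0 M z)]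
      exact hRle M z)
  have hRlim : Tendsto (fun M => ∫ z, R M z ∂ν) atTop (𝓝 0) := by
    rw [← integral_zero E ℝ (μ := ν)]
    refine tendsto_integral_of_dominated_convergence (fun z => |H z|) hRm hH.abs
      (fun M => Eventually.of_forall fun z => ?_) (Eventually.of_forall fun z => ?_)
    · rw [Real.norm_of_nonneg (hR0 M z)]
      exact hRle M z
    · refine tendsto_const_nhds.congr' ?_
      filter_upwards [eventually_ge_atTop ⌈|H z|⌉₊] with M hM
      simp [R, min_eq_left (Nat.ceil_le.1 hM)]
  rw [Metric.tendsto_nhds]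
  intro r hr
  have h0 := hRlim.const_mul |B|
  rw [mul_zero] at h0
  obtain ⟨M, hM⟩ := (h0.eventually_lt_const (half_pos hr)).exists
  have h1 := hW1.const_mul (M : ℝ)
  rw [mul_zero] at h1
  filter_upwards [h1.eventually_lt_const (half_pos hr)] with i hi
  rw [dist_zero_right, Real.norm_of_nonneg
    (integral_nonneg fun _ => mul_nonneg (abs_nonneg _) (abs_nonneg _))]
  have hWi : Integrable (fun ω => |W i ω|) P :=
    (Integrable.of_bound (hWm i).aestronglyMeasurable B (hWB i)).abs
  have hRX : Integrable (fun ω => R M (X i ω)) P := by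
    have := hRi M
    rw [← (hX i).map_eq] at this
    exact this.comp_aemeasurable (hX i).aemeasurable
  have hle : ∫ ω, |H (X i ω)| * |W i ω| ∂P ≤ ∫ ω, (M * |W i ω| + |B| * R M (X i ω)) ∂P := by
    refine integral_mono_of_nonneg
      (Eventually.of_forall fun _ => mul_nonneg (abs_nonneg _) (abs_nonneg _))
      ((hWi.const_mul _).add (hRX.const_mul _)) ?_
    filter_upwards [hWB i] with ω hω
    have e : |H (X i ω)| = min |H (X i ω)| M + R M (X i ω) := by simp [R]
    have e1 : min |H (X i ω)| M * |W i ω| ≤ M * |W i ω| := by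
      gcongr
      exact min_le_right _ _
    have e2 : R M (X i ω) * |W i ω| ≤ R M (X i ω) * |B| :=
      mul_le_mul_of_nonneg_left (hω.trans (le_abs_self _)) (hR0 _ _)
    nlinarith [e, e1, e2]
  rw [integral_add (hWi.const_mul _) (hRX.const_mul _), integral_const_mul, integral_const_mul,
    show ∫ ω, R M (X i ω) ∂P = ∫ z, R M z ∂ν from (hX i).integral_comp (hRm M)] at hle
  linarith

end ConvergenceInMeasure

/-! ### A weak law from decaying correlations. -/

section WeakLaw

variable {Ω : Type*} [MeasurableSpace Ω] {P : Measure Ω}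

lemma integral_mul_le_sqrt_mul_sqrt {f g : Ω → ℝ} (hf : MemLp f 2 P) (hg : MemLp g 2 P) :
    ∫ ω, |f ω| * |g ω| ∂P ≤ √(∫ ω, f ω ^ 2 ∂P) * √(∫ ω, g ω ^ 2 ∂P) := by
  have h := integral_mul_norm_le_Lp_mul_Lq (μ := P) (f := f) (g := g) Real.HolderConjugate.two_two
    (by simpa using hf) (by simpa using hg)
  simpa [Real.sqrt_eq_rpow] using h

/-- Second moment of a sum of variables with small correlations. -/
lemma integral_sq_sum_le {Z : ℕ → Ω → ℝ} (hZ : ∀ t, MemLp (Z t) 2 P) {C : ℝ}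
    (hC : ∀ t, ∫ ω, Z t ω ^ 2 ∂P ≤ C) {c : ℕ → ℝ}
    (hc : ∀ s t, s < t → ∫ ω, Z s ω * Z t ω ∂P ≤ c t) (n : ℕ) :
    ∫ ω, (∑ t ∈ Finset.range n, Z t ω) ^ 2 ∂P ≤ ∑ t ∈ Finset.range n, (2 * (t * c t) + C) := by
  have hS : ∀ n, MemLp (fun ω => ∑ t ∈ Finset.range n, Z t ω) 2 P := fun n =>
    memLp_finsetSum _ fun t _ => hZ t
  induction n with
  | zero => simp
  | succ n ih =>
    have e : ∀ ω, (∑ t ∈ Finset.range (n + 1), Z t ω) ^ 2 = (∑ t ∈ Finset.range n, Z t ω) ^ 2 +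
        (2 * ∑ t ∈ Finset.range n, Z t ω * Z n ω + Z n ω ^ 2) := fun ω => by
      rw [Finset.sum_range_succ, ← Finset.sum_mul]
      ring
    have hi : ∀ t ∈ Finset.range n, Integrable (fun ω => Z t ω * Z n ω) P :=
      fun t _ => (hZ t).integrable_mul (hZ n)
    have hi2 : Integrable (fun ω => 2 * ∑ t ∈ Finset.range n, Z t ω * Z n ω) P :=
      (integrable_finsetSum _ hi).const_mul 2
    have hi3 : Integrable (fun ω => 2 * ∑ t ∈ Finset.range n, Z t ω * Z n ω + Z n ω ^ 2) P :=
      hi2.add (hZ n).integrable_sq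
    simp only [e]
    rw [integral_add (hS n).integrable_sq hi3, integral_add hi2 (hZ n).integrable_sq,
      integral_const_mul, integral_finsetSum _ hi, Finset.sum_range_succ]
    -- The new index `n` meets `n` earlier ones, each pair appearing twice in the square: this is
    -- the term `2 * (n * c n)`.
    have : ∑ t ∈ Finset.range n, ∫ ω, Z t ω * Z n ω ∂P ≤ n * c n := by
      simpa using Finset.sum_le_sum fun t ht => hc t n (Finset.mem_range.1 ht)
    linarith [hC n]

/-- Weak law of large numbers for variables with correlations tending to `0`. -/
lemma tendstoInMeasure_average [IsProbabilityMeasure P] {Z : ℕ → Ω → ℝ} {m : ℝ}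
    (hZ : ∀ t, MemLp (Z t) 2 P) {C : ℝ} (hC : ∀ t, ∫ ω, (Z t ω - m) ^ 2 ∂P ≤ C) {c : ℕ → ℝ}
    (hc : ∀ s t, s < t → ∫ ω, (Z s ω - m) * (Z t ω - m) ∂P ≤ c t) (hc0 : ∀ t, 0 ≤ c t)
    (hlim : Tendsto c atTop (𝓝 0)) :
    TendstoInMeasure P (fun (n : ℕ) ω => (1 / (n : ℝ)) * ∑ t ∈ Finset.range n, Z t ω) atTop
      fun _ => m := by
  have hZm : ∀ t, MemLp (fun ω => Z t ω - m) 2 P := fun t => (hZ t).sub (memLp_const m)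
  have hS : ∀ n : ℕ, MemLp (fun ω => (1 / (n : ℝ)) * ∑ t ∈ Finset.range n, Z t ω) 2 P := fun n =>
    (memLp_finsetSum _ fun t _ => hZ t).const_mul _
  refine tendstoInMeasure_of_tendsto_integral_sq
    (fun n => ((hS n).sub (memLp_const m)).integrable_sq) ?_
  -- After division by $n^2$, the bound $t\le n$ turns $\sum_t t\,c_t$ into a Cesàro mean of `c`.
  have hb : Tendsto (fun n : ℕ => 2 * ((n : ℝ)⁻¹ * ∑ t ∈ Finset.range n, c t) + C * (n : ℝ)⁻¹)
      atTop (𝓝 0) := by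
    simpa using (hlim.cesaro.const_mul 2).add (tendsto_inv_atTop_nhds_zero_nat.const_mul C)
  refine tendsto_of_tendsto_of_tendsto_of_le_of_le' tendsto_const_nhds hb
    (Eventually.of_forall fun n => integral_nonneg fun _ => sq_nonneg _) ?_
  filter_upwards [eventually_gt_atTop 0] with n hn
  have hn' : (0 : ℝ) < n := by exact_mod_cast hn
  have e : ∀ ω, ((1 / (n : ℝ)) * ∑ t ∈ Finset.range n, Z t ω - m) ^ 2 =
      (1 / (n : ℝ) ^ 2) * (∑ t ∈ Finset.range n, (Z t ω - m)) ^ 2 := fun ω => by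
    rw [Finset.sum_sub_distrib]
    simp
    field_simp
  simp only [e]
  rw [integral_const_mul]
  have h1 := integral_sq_sum_le hZm hC hc n
  have h2 : ∑ t ∈ Finset.range n, (2 * (t * c t) + C) ≤
      n * (2 * ∑ t ∈ Finset.range n, c t + C) := by
    rw [Finset.sum_add_distrib, mul_add, Finset.mul_sum, Finset.mul_sum]
    simp only [Finset.sum_const, Finset.card_range, nsmul_eq_mul]
    refine add_le_add_left (Finset.sum_le_sum fun t ht => ?_) _
    have : (t : ℝ) ≤ n := by exact_mod_cast (Finset.mem_range.1 ht).le
    have := mul_le_mul_of_nonneg_right this (hc0 t)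
    linarith
  calc 1 / (n : ℝ) ^ 2 * ∫ ω, (∑ t ∈ Finset.range n, (Z t ω - m)) ^ 2 ∂P
      ≤ 1 / (n : ℝ) ^ 2 * (n * (2 * ∑ t ∈ Finset.range n, c t + C)) := by
        gcongr
        exact h1.trans h2
    _ = _ := by field_simp

end WeakLaw

/-! ### A martingale central limit theorem by characteristic functions. -/

section MartingaleCLT

/-- For $|x|\le1$ the exponential series gives $e|x|^3$. For $|x|>1$ the four terms are bounded
separately by $|x|^3$ times $1$, $1$, $1$ and $1/2$. The bound is global, so third moments suffice
and no truncation is needed. -/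
lemma norm_cexp_mul_I_sub_le (x : ℝ) :
    ‖Complex.exp (x * Complex.I) - (1 + x * Complex.I - (x : ℂ) ^ 2 / 2)‖ ≤ 4 * |x| ^ 3 := by
  have hn : ‖(x : ℂ) * Complex.I‖ = |x| := by simp
  rcases le_or_gt |x| 1 with h | h
  · have h1 := Complex.norm_exp_sub_sum_le_norm_mul_exp ((x : ℂ) * Complex.I) 3
    have e : ∑ m ∈ Finset.range 3, ((x : ℂ) * Complex.I) ^ m / (m.factorial : ℂ) =
        1 + x * Complex.I - (x : ℂ) ^ 2 / 2 := by
      simp [Finset.sum_range_succ, mul_pow]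
      ring
    rw [e, hn] at h1
    refine h1.trans ?_
    rw [mul_comm]
    gcongr
    have := Real.exp_le_exp.2 h
    linarith [Real.exp_one_lt_d9]
  · have h1 : ‖Complex.exp (x * Complex.I) - (1 + x * Complex.I - (x : ℂ) ^ 2 / 2)‖ ≤
        1 + (1 + |x| + |x| ^ 2 / 2) := by
      refine (norm_sub_le _ _).trans ?_
      rw [Complex.norm_exp_ofReal_mul_I]
      gcongr
      refine (norm_sub_le _ _).trans (add_le_add ((norm_add_le _ _).trans ?_) ?_)
      · simp
      · simp
    have h2 : 1 ≤ |x| ^ 3 := one_le_pow₀ h.le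
    have h3 : |x| ≤ |x| ^ 3 := by simpa using pow_le_pow_right₀ h.le (show 1 ≤ 3 by norm_num)
    have h4 : |x| ^ 2 ≤ |x| ^ 3 := pow_le_pow_right₀ h.le (by norm_num)
    linarith

/-- The error of each step is carried forward by multiplication by `q`, which does not enlarge it.
-/
lemma norm_sub_pow_le_sum {φ : ℕ → ℂ} {q : ℂ} {e : ℕ → ℝ} (h0 : φ 0 = 1) (hq : ‖q‖ ≤ 1)
    (h : ∀ n, ‖φ (n + 1) - q * φ n‖ ≤ e n) (n : ℕ) :
    ‖φ n - q ^ n‖ ≤ ∑ k ∈ Finset.range n, e k := by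
  induction n with
  | zero => simp [h0]
  | succ n ih =>
    rw [Finset.sum_range_succ]
    have e1 : φ (n + 1) - q ^ (n + 1) = q * (φ n - q ^ n) + (φ (n + 1) - q * φ n) := by ring
    rw [e1]
    refine (norm_add_le _ _).trans (add_le_add ?_ (h n))
    rw [norm_mul]
    exact (mul_le_of_le_one_left (norm_nonneg _) hq).trans ih

variable {Ω : Type*} [MeasurableSpace Ω] {P : Measure Ω} [IsProbabilityMeasure P]

lemma integrable_cexp_mul_I {X : Ω → ℝ} (hX : Measurable X) (s : ℝ) :
    Integrable (fun ω => Complex.exp (s * X ω * Complex.I)) P :=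
  Integrable.of_bound (by fun_prop) 1 (Eventually.of_forall fun ω => by
    rw [← Complex.ofReal_mul, Complex.norm_exp_ofReal_mul_I])

/-- One step of the recursion for the characteristic function of a sum whose increment is
centered and has variance about `v` given the past. -/
lemma norm_integral_cexp_add_sub_le {S ξ : Ω → ℝ} (hS : Measurable S) (hξ : Measurable ξ)
    (h3 : Integrable (fun ω => |ξ ω| ^ 3) P) {C v c s : ℝ} (hC : ∫ ω, |ξ ω| ^ 3 ∂P ≤ C)
    (horth : ∫ ω, ξ ω • Complex.exp (s * S ω * Complex.I) ∂P = 0)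
    (hvar : ‖∫ ω, ξ ω ^ 2 • Complex.exp (s * S ω * Complex.I) ∂P -
      v • ∫ ω, Complex.exp (s * S ω * Complex.I) ∂P‖ ≤ c) :
    ‖∫ ω, Complex.exp (s * (S ω + ξ ω : ℝ) * Complex.I) ∂P -
      ((1 - s ^ 2 * v / 2 : ℝ) : ℂ) * ∫ ω, Complex.exp (s * S ω * Complex.I) ∂P‖ ≤
      s ^ 2 / 2 * c + 4 * |s| ^ 3 * C := by
  set a : Ω → ℂ := fun ω => Complex.exp (s * S ω * Complex.I) with ha
  have han : ∀ ω, ‖a ω‖ = 1 := fun ω => by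
    rw [ha]
    simp only
    rw [← Complex.ofReal_mul, Complex.norm_exp_ofReal_mul_I]
  have hai : Integrable a P := integrable_cexp_mul_I hS s
  have ham : Measurable a := by fun_prop
  have hξ1 : Integrable ξ P := by
    refine Integrable.mono' (h3.add (integrable_const 1)) hξ.aestronglyMeasurable
      (Eventually.of_forall fun ω => ?_)
    simp only [Pi.add_apply, Real.norm_eq_abs]
    rcases le_or_gt |ξ ω| 1 with h | h
    · linarith [pow_nonneg (abs_nonneg (ξ ω)) 3]
    · have : |ξ ω| ≤ |ξ ω| ^ 3 := by simpa using pow_le_pow_right₀ h.le (show 1 ≤ 3 by norm_num)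
      linarith
  have hξ2 : Integrable (fun ω => ξ ω ^ 2) P := by
    refine Integrable.mono' (h3.add (integrable_const 1)) (by fun_prop)
      (Eventually.of_forall fun ω => ?_)
    simp only [Pi.add_apply, norm_pow, Real.norm_eq_abs]
    rcases le_or_gt |ξ ω| 1 with h | h
    · have := pow_le_one₀ (n := 2) (abs_nonneg _) h
      linarith [pow_nonneg (abs_nonneg (ξ ω)) 3]
    · have : |ξ ω| ^ 2 ≤ |ξ ω| ^ 3 := pow_le_pow_right₀ h.le (by norm_num)
      linarith
  have hi1 : Integrable (fun ω => ξ ω • a ω) P :=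
    hξ1.smul_bdd 1 ham.aestronglyMeasurable (Eventually.of_forall fun ω => (han ω).le)
  have hi2 : Integrable (fun ω => ξ ω ^ 2 • a ω) P :=
    hξ2.smul_bdd 1 ham.aestronglyMeasurable (Eventually.of_forall fun ω => (han ω).le)
  -- The third-order Taylor remainder of $e^{is\xi}$, times the unimodular factor `a`. In the
  -- expansion below the linear term integrates to zero by `horth`, and the quadratic term costs `c`
  -- when `ξ ^ 2` is replaced by `v`.
  let r : Ω → ℂ := fun ω => a ω * (Complex.exp ((s * ξ ω : ℝ) * Complex.I) -
    (1 + (s * ξ ω : ℝ) * Complex.I - ((s * ξ ω : ℝ) : ℂ) ^ 2 / 2))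
  have hrn : ∀ ω, ‖r ω‖ ≤ 4 * |s| ^ 3 * |ξ ω| ^ 3 := fun ω => by
    simp only [r]
    rw [norm_mul, han, one_mul]
    refine (norm_cexp_mul_I_sub_le _).trans_eq ?_
    rw [abs_mul]
    ring
  have hri : Integrable r P := Integrable.mono' (h3.const_mul (4 * |s| ^ 3))
    (by fun_prop) (Eventually.of_forall hrn)
  have e : ∀ ω, Complex.exp (s * (S ω + ξ ω : ℝ) * Complex.I) =
      (r ω + (s * Complex.I) * (ξ ω • a ω)) + (a ω - ((s ^ 2 / 2 : ℝ) : ℂ) * (ξ ω ^ 2 • a ω)) := by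
    intro ω
    have : Complex.exp (s * (S ω + ξ ω : ℝ) * Complex.I) =
        a ω * Complex.exp ((s * ξ ω : ℝ) * Complex.I) := by
      rw [ha, ← Complex.exp_add]
      congr 1
      push_cast
      ring
    rw [this]
    simp only [r, Complex.real_smul]
    push_cast
    ring
  have hint : ∫ ω, Complex.exp (s * (S ω + ξ ω : ℝ) * Complex.I) ∂P =
      ∫ ω, r ω ∂P + (∫ ω, a ω ∂P - ((s ^ 2 / 2 : ℝ) : ℂ) * ∫ ω, ξ ω ^ 2 • a ω ∂P) := by
    simp only [e]
    have hi1' : Integrable (fun ω => (s * Complex.I) * (ξ ω • a ω)) P := hi1.const_mul _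
    have hi2' : Integrable (fun ω => ((s ^ 2 / 2 : ℝ) : ℂ) * (ξ ω ^ 2 • a ω)) P := hi2.const_mul _
    have hi3 : Integrable (fun ω => r ω + (s * Complex.I) * (ξ ω • a ω)) P := hri.add hi1'
    have hi4 : Integrable (fun ω => a ω - ((s ^ 2 / 2 : ℝ) : ℂ) * (ξ ω ^ 2 • a ω)) P :=
      hai.sub hi2'
    rw [integral_add hi3 hi4, integral_add hri hi1', integral_sub hai hi2',
      integral_const_mul, integral_const_mul, horth]
    ring
  rw [hint]
  have e2 : ∫ ω, r ω ∂P + (∫ ω, a ω ∂P - ((s ^ 2 / 2 : ℝ) : ℂ) * ∫ ω, ξ ω ^ 2 • a ω ∂P) -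
      ((1 - s ^ 2 * v / 2 : ℝ) : ℂ) * ∫ ω, a ω ∂P =
      -(((s ^ 2 / 2 : ℝ) : ℂ) * (∫ ω, ξ ω ^ 2 • a ω ∂P - v • ∫ ω, a ω ∂P)) + ∫ ω, r ω ∂P := by
    rw [Complex.real_smul]
    push_cast
    ring
  rw [e2]
  refine (norm_add_le _ _).trans (add_le_add ?_ ?_)
  · rw [norm_neg, norm_mul, Complex.norm_real, Real.norm_of_nonneg (by positivity)]
    gcongr
  · refine (norm_integral_le_integral_norm _).trans ?_
    calc ∫ ω, ‖r ω‖ ∂P ≤ ∫ ω, 4 * |s| ^ 3 * |ξ ω| ^ 3 ∂P :=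
          integral_mono hri.norm (h3.const_mul _) hrn
      _ ≤ 4 * |s| ^ 3 * C := by
          rw [integral_const_mul]
          gcongr

/-- Central limit theorem for martingale-like differences with bounded third moments whose
conditional variances converge to a constant. -/
theorem tendstoInDistribution_inv_sqrt_mul_sum_of_orthogonal {ξ : ℕ → Ω → ℝ}
    (hξ : ∀ t, Measurable (ξ t)) (h3 : ∀ t, Integrable (fun ω => |ξ t ω| ^ 3) P) {C v : ℝ}
    (hC : ∀ t, ∫ ω, |ξ t ω| ^ 3 ∂P ≤ C) (hv : 0 ≤ v) {c : ℕ → ℝ} (hc : Tendsto c atTop (𝓝 0))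
    (horth : ∀ (t : ℕ) (s : ℝ), ∫ ω, ξ t ω •
      Complex.exp (s * (∑ k ∈ Finset.range t, ξ k ω : ℝ) * Complex.I) ∂P = 0)
    (hvar : ∀ (t : ℕ) (s : ℝ), ‖∫ ω, ξ t ω ^ 2 •
      Complex.exp (s * (∑ k ∈ Finset.range t, ξ k ω : ℝ) * Complex.I) ∂P -
        v • ∫ ω, Complex.exp (s * (∑ k ∈ Finset.range t, ξ k ω : ℝ) * Complex.I) ∂P‖ ≤ c t) :
    TendstoInDistribution (fun (n : ℕ) ω => (√(n : ℝ))⁻¹ * ∑ t ∈ Finset.range n, ξ t ω)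
      atTop id (fun _ => P) (gaussianReal 0 v.toNNReal) where
  forall_aemeasurable n := by fun_prop
  aemeasurable_limit := aemeasurable_id
  tendsto := by
    refine ProbabilityMeasure.tendsto_iff_tendsto_charFun.2 fun u => ?_
    simp only [ProbabilityMeasure.coe_mk, Measure.map_id, charFun_gaussianReal]
    -- Frequency and number of summands are separate arguments: the recursion runs over the summands
    -- at a frozen frequency, which is then set to $u/\sqrt n$.
    let φ : ℝ → ℕ → ℂ := fun s n =>
      ∫ ω, Complex.exp (s * (∑ k ∈ Finset.range n, ξ k ω : ℝ) * Complex.I) ∂P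
    have hchar : ∀ n : ℕ, charFun (P.map fun ω => (√(n : ℝ))⁻¹ * ∑ t ∈ Finset.range n, ξ t ω) u =
        φ ((√(n : ℝ))⁻¹ * u) n := fun n => by
      rw [charFun_apply_real, integral_map (by fun_prop) (by fun_prop)]
      refine integral_congr_ae (Eventually.of_forall fun ω => ?_)
      simp only
      congr 2
      push_cast
      ring
    simp only [hchar]
    have hstep : ∀ s n, ‖φ s (n + 1) - ((1 - s ^ 2 * v / 2 : ℝ) : ℂ) * φ s n‖ ≤
        s ^ 2 / 2 * c n + 4 * |s| ^ 3 * C := fun s n => by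
      have h := norm_integral_cexp_add_sub_le (S := fun ω => ∑ k ∈ Finset.range n, ξ k ω)
        (by fun_prop) (hξ n) (h3 n) (hC n) (horth n s) (hvar n s)
      simpa only [φ, Finset.sum_range_succ] using h
    have hs2 : ∀ᶠ n : ℕ in atTop, ((√(n : ℝ))⁻¹ * u) ^ 2 = u ^ 2 / n := by
      filter_upwards with n
      rw [mul_pow, inv_pow, Real.sq_sqrt (Nat.cast_nonneg _)]
      ring
    -- The factor has modulus at most $1$ only once $u^2v/(2n)\le2$.
    have hq : ∀ᶠ n : ℕ in atTop, ‖((1 - ((√(n : ℝ))⁻¹ * u) ^ 2 * v / 2 : ℝ) : ℂ)‖ ≤ 1 := by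
      have : Tendsto (fun n : ℕ => u ^ 2 / (n : ℝ) * v / 2) atTop (𝓝 0) := by
        simpa using ((tendsto_const_div_atTop_nhds_zero_nat (u ^ 2)).mul_const v).div_const 2
      filter_upwards [hs2, this.eventually_le_const (show (0 : ℝ) < 2 by norm_num)] with n hn hle
      rw [hn, Complex.norm_real, Real.norm_eq_abs, abs_le]
      have : 0 ≤ u ^ 2 / (n : ℝ) * v / 2 := by positivity
      constructor <;> linarith
    have hpow : Tendsto (fun n : ℕ => ((1 - ((√(n : ℝ))⁻¹ * u) ^ 2 * v / 2 : ℝ) : ℂ) ^ n) atTop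
        (𝓝 (Complex.exp (u * (0 : ℝ) * Complex.I - v.toNNReal * u ^ 2 / 2))) := by
      have h := (Complex.continuous_ofReal.tendsto _).comp
        (Real.tendsto_one_add_div_pow_exp (-(u ^ 2 * v / 2)))
      have e : ((Real.exp (-(u ^ 2 * v / 2)) : ℝ) : ℂ) =
          Complex.exp (u * (0 : ℝ) * Complex.I - v.toNNReal * u ^ 2 / 2) := by
        rw [Complex.ofReal_exp]
        congr 1
        rw [show ((v.toNNReal : NNReal) : ℂ) = ((v.toNNReal : ℝ) : ℂ) from rfl,
          Real.coe_toNNReal _ hv]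
        push_cast
        ring
      rw [e] at h
      refine h.congr' ?_
      filter_upwards [hs2] with n hn
      rw [hn]
      simp only [Function.comp_apply]
      push_cast
      ring
    refine (tendsto_iff_of_dist ?_).2 hpow
    -- The `n` one-step errors at $s=u/\sqrt n$ add up to $\frac{u^2}{2}$ times the mean of `c`,
    -- plus $4|u|^3C/\sqrt n$.
    have hb : Tendsto (fun n : ℕ => u ^ 2 / 2 * ((n : ℝ)⁻¹ * ∑ k ∈ Finset.range n, c k) +
        4 * |u| ^ 3 * C * (√(n : ℝ))⁻¹) atTop (𝓝 0) := by
      have : Tendsto (fun n : ℕ => (√(n : ℝ))⁻¹) atTop (𝓝 0) := tendsto_inv_atTop_zero.comp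
        (Real.tendsto_sqrt_atTop.comp tendsto_natCast_atTop_atTop)
      simpa using (hc.cesaro.const_mul (u ^ 2 / 2)).add (this.const_mul (4 * |u| ^ 3 * C))
    refine tendsto_of_tendsto_of_tendsto_of_le_of_le' tendsto_const_nhds hb
      (Eventually.of_forall fun _ => dist_nonneg) ?_
    filter_upwards [hq, hs2, eventually_gt_atTop 0] with n hn hs hn0
    rw [dist_eq_norm]
    have hφ0 : φ ((√(n : ℝ))⁻¹ * u) 0 = 1 := by simp [φ]
    refine (norm_sub_pow_le_sum hφ0 hn (hstep _) n).trans_eq ?_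
    have hn' : (0 : ℝ) < n := by exact_mod_cast hn0
    rw [Finset.sum_add_distrib, ← Finset.mul_sum, hs, abs_mul, abs_of_pos (by positivity)]
    simp only [Finset.sum_const, Finset.card_range, nsmul_eq_mul]
    have hsq : (n : ℝ) = √(n : ℝ) ^ 2 := (Real.sq_sqrt hn'.le).symm
    have hsp : 0 < √(n : ℝ) := Real.sqrt_pos.2 hn'
    congr 1
    · ring
    · nth_rewrite 1 [hsq]
      field_simp

end MartingaleCLT

/-! ### Inverse powers of probabilities bounded below. -/

lemma tendstoInMeasure_zero_of_ae_abs_le {Ω ι : Type*} [MeasurableSpace Ω] {P : Measure Ω}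
    {l : Filter ι} {U W : ι → Ω → ℝ} {L : ℝ} (hU : TendstoInMeasure P U l fun _ => 0)
    (h : ∀ i, ∀ᵐ ω ∂P, |W i ω| ≤ L * |U i ω|) : TendstoInMeasure P W l fun _ => 0 := by
  rw [tendstoInMeasure_iff_dist] at hU ⊢
  simp only [dist_zero_right, Real.norm_eq_abs] at hU ⊢
  intro ε hε
  refine tendsto_of_tendsto_of_tendsto_of_le_of_le tendsto_const_nhds
    (hU (ε / (|L| + 1)) (by positivity)) (fun _ => zero_le) fun i => measure_mono_ae ?_
  filter_upwards [h i] with ω hω hε'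
  change ε ≤ |W i ω| at hε'
  change ε / (|L| + 1) ≤ |U i ω|
  rw [div_le_iff₀ (by positivity)]
  nlinarith [abs_nonneg (U i ω), le_abs_self L]

/-- The power map is `j`-Lipschitz on $[0,1]$, and the common denominator is at least `c ^ j * c ^
j`. This carries convergence of the policy over to its inverse powers. -/
lemma abs_inv_pow_sub_inv_pow_le {c x y : ℝ} (hc : 0 < c) (hx : c ≤ x) (hy : c ≤ y) (hx1 : x ≤ 1)
    (hy1 : y ≤ 1) (j : ℕ) : |(x ^ j)⁻¹ - (y ^ j)⁻¹| ≤ j / (c ^ j * c ^ j) * |x - y| := by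
  have hx0 := hc.trans_le hx
  have hy0 := hc.trans_le hy
  rw [inv_sub_inv (pow_pos hx0 j).ne' (pow_pos hy0 j).ne', abs_div, abs_of_pos (by positivity :
    0 < x ^ j * y ^ j), div_mul_eq_mul_div]
  have h1 : |y ^ j - x ^ j| ≤ j * |x - y| := by
    refine (abs_pow_sub_pow_le y x j).trans ?_
    rw [abs_sub_comm y x, mul_assoc, mul_comm]
    gcongr
    refine mul_le_of_le_one_right (Nat.cast_nonneg _) (pow_le_one₀ (by positivity) ?_)
    rw [abs_of_pos hx0, abs_of_pos hy0]
    exact max_le hy1 hx1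
  gcongr

/-- Both inverses lie between $0$ and $c^{-j}$. This uniform bound turns convergence in measure into
convergence of expectations. -/
lemma abs_inv_pow_sub_inv_pow_le_inv {c x y : ℝ} (hc : 0 < c) (hx : c ≤ x) (hy : c ≤ y) (j : ℕ) :
    |(x ^ j)⁻¹ - (y ^ j)⁻¹| ≤ (c ^ j)⁻¹ := by
  have hx0 := hc.trans_le hx
  have hy0 := hc.trans_le hy
  have h1 : (x ^ j)⁻¹ ≤ (c ^ j)⁻¹ := by gcongr
  have h2 : (y ^ j)⁻¹ ≤ (c ^ j)⁻¹ := by gcongr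
  have h3 : 0 ≤ (x ^ j)⁻¹ := by positivity
  have h4 : 0 ≤ (y ^ j)⁻¹ := by positivity
  rw [abs_le]
  constructor <;> linarith

/-! ### Action selection in the bandit experiment. -/

namespace OffPolicy

lemma StochasticPolicy.prob_le_one {S : Type*} [MeasurableSpace S] {K : ℕ}
    (π : StochasticPolicy S K) (s : S) (a : Fin K) : π.prob s a ≤ 1 := by
  rw [← π.sum_eq_one s]
  exact Finset.single_le_sum (fun b _ => π.nonneg s b) (Finset.mem_univ a)

variable {Ω 𝒳 : Type*} [MeasurableSpace Ω] [MeasurableSpace 𝒳] {K : ℕ}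
  {P : Measure Ω} {ν : Measure (𝒳 × (Fin K → ℝ))} {π : BehaviorPolicy 𝒳 K}
  {D : BanditData Ω 𝒳 K}

namespace IsBanditExperiment

lemma measurable_Yobs (hD : IsBanditExperiment P ν π D) (t : ℕ) : Measurable (D.Yobs t) :=
  (measurable_from_prod_countable_right (f := fun q : Fin K × Ω => D.Y t q.1 q.2)
    (hD.measurable_Y t)).comp ((hD.measurable_A t).prodMk measurable_id)

/-- The history contains the earlier recorded probabilities, while each recorded probability is a
function of the history; hence a joint strong induction. -/
lemma measurable_hist_and_p (hD : IsBanditExperiment P ν π D) (t : ℕ) :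
    Measurable (D.hist t) ∧ Measurable (D.p t) := by
  induction t using Nat.strong_induction_on with
  | _ t ih =>
    have hh : Measurable (D.hist t) := measurable_pi_lambda _ fun τ =>
      (hD.measurable_X τ).prodMk ((ih τ τ.2).2.prodMk
        ((hD.measurable_A τ).prodMk (hD.measurable_Yobs τ)))
    refine ⟨hh, ?_⟩
    rw [show D.p t = _ from funext (hD.recorded t)]
    exact (measurable_from_prod_countable_right
      (f := fun q : Fin K × (History 𝒳 K t × 𝒳) => (π t).prob q.2 q.1) (π t).measurable).comp
      ((hD.measurable_A t).prodMk (hh.prodMk (hD.measurable_X t)))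

lemma measurable_hist (hD : IsBanditExperiment P ν π D) (t : ℕ) : Measurable (D.hist t) :=
  (hD.measurable_hist_and_p t).1

lemma measurable_p (hD : IsBanditExperiment P ν π D) (t : ℕ) : Measurable (D.p t) :=
  (hD.measurable_hist_and_p t).2

lemma measurable_histX (hD : IsBanditExperiment P ν π D) (t : ℕ) : Measurable (D.histX t) :=
  (hD.measurable_hist t).prodMk (hD.measurable_X t)

lemma measurable_env (hD : IsBanditExperiment P ν π D) (t : ℕ) : Measurable (D.env t) :=
  (hD.measurable_X t).prodMk (measurable_pi_lambda _ (hD.measurable_Y t))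

lemma measurable_prob (hD : IsBanditExperiment P ν π D) (t : ℕ) (a : Fin K) :
    Measurable fun ω => (π t).prob (D.histX t ω) a :=
  ((π t).measurable a).comp (hD.measurable_histX t)

/-- The limiting policy inherits the lower bound on the sampling probability. -/
lemma ae_le_limit_prob (hD : IsBanditExperiment P ν π D) {πbar : StochasticPolicy 𝒳 K}
    (hconv : PolicyConverges P π D πbar) {a : Fin K} {c : ℝ}
    (hmin : ∀ t, ∀ᵐ ω ∂P, c ≤ (π t).prob (D.histX t ω) a) :
    ∀ᵐ z ∂ν, c ≤ πbar.prob z.1 a := by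
  have hpm : Measurable fun z : 𝒳 × (Fin K → ℝ) => πbar.prob z.1 a :=
    (πbar.measurable a).comp measurable_fst
  -- This event for $X_t$ forces a gap of at least `ε` between $\pi_t$ and `πbar`. Its probability
  -- is the same for all `t`, yet bounded by a sequence tending to $0$.
  have h0 : ∀ ε > 0, ν {z | πbar.prob z.1 a + ε ≤ c} = 0 := by
    intro ε hε
    have hms : MeasurableSet {z : 𝒳 × (Fin K → ℝ) | πbar.prob z.1 a + ε ≤ c} :=
      measurableSet_le (hpm.add_const ε) measurable_const
    have hlim := tendstoInMeasure_iff_dist.1 (hconv a) ε hε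
    refine le_antisymm (ge_of_tendsto' hlim fun t => ?_) zero_le
    rw [← (hD.hasLaw t).measure_eq hms]
    refine measure_mono_ae ?_
    filter_upwards [hmin t] with ω hω hε'
    change πbar.prob (D.X t ω) a + ε ≤ c at hε'
    change ε ≤ dist _ (0 : ℝ)
    rw [dist_zero_right, Real.norm_eq_abs]
    refine le_trans ?_ (le_abs_self _)
    linarith
  have h1 : ∀ᵐ z ∂ν, ∀ n : ℕ, ¬ (πbar.prob z.1 a + 1 / ((n : ℝ) + 1) ≤ c) := by
    rw [ae_all_iff]
    intro n
    rw [ae_iff]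
    simpa only [not_not] using h0 (1 / ((n : ℝ) + 1)) (by positivity)
  filter_upwards [h1] with z hz
  by_contra hlt
  obtain ⟨n, hn⟩ := exists_nat_one_div_lt (sub_pos.2 (not_le.1 hlt))
  exact hz n (by linarith)

variable [IsProbabilityMeasure P]

/-- Given history and context, selecting an action amounts to weighting the law of the potential
outcomes by the selection probability. -/
lemma map_restrict_selection (hD : IsBanditExperiment P ν π D) (hu : Unconfounded P D) (t : ℕ)
    (a : Fin K) :
    (P.restrict (D.A t ⁻¹' {a})).map (fun ω => (D.histX t ω, fun b => D.Y t b ω)) =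
      (P.withDensity fun ω => ENNReal.ofReal ((π t).prob (D.histX t ω) a)).map
        (fun ω => (D.histX t ω, fun b => D.Y t b ω)) := by
  have hYm : Measurable fun ω => fun b => D.Y t b ω := measurable_pi_lambda _ (hD.measurable_Y t)
  have hm := (hD.measurable_histX t).prodMk hYm
  refine Measure.ext_prod fun {s u} hs hu' => ?_
  rw [Measure.map_apply hm (hs.prod hu'), Measure.map_apply hm (hs.prod hu')]
  set S := D.histX t ⁻¹' s with hSdef
  set U := (fun ω => fun b => D.Y t b ω) ⁻¹' u with hUdef
  have hpre : (fun ω => (D.histX t ω, fun b => D.Y t b ω)) ⁻¹' s ×ˢ u = S ∩ U := rfl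
  rw [hpre]
  have hS : MeasurableSet S := hD.measurable_histX t hs
  have hU : MeasurableSet U := hYm hu'
  have hA : MeasurableSet (D.A t ⁻¹' {a}) := hD.measurable_A t (measurableSet_singleton a)
  rw [Measure.restrict_apply (hS.inter hU), withDensity_apply _ (hS.inter hU),
    ← ofReal_integral_eq_lintegral_ofReal ?_ (Eventually.of_forall fun _ => (π t).nonneg _ _)]
  swap
  · refine Integrable.of_bound (hD.measurable_prob t a).aestronglyMeasurable 1
      (Eventually.of_forall fun ω => ?_)
    rw [Real.norm_of_nonneg ((π t).nonneg _ _)]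
    exact (π t).prob_le_one _ _
  have hle : D.sigmaHistX t ≤ _ := (hD.measurable_histX t).comap_le
  have hSm : MeasurableSet[D.sigmaHistX t] S := ⟨s, hs, rfl⟩
  have hi : ∀ V : Set Ω, MeasurableSet V → Integrable (V.indicator fun _ => (1 : ℝ)) P :=
    fun V hV => (integrable_const 1).indicator hV
  have hprob : StronglyMeasurable[D.sigmaHistX t] fun ω => (π t).prob (D.histX t ω) a :=
    (((π t).measurable a).comp (comap_measurable (D.histX t))).stronglyMeasurable
  have hprodi : Integrable
      ((fun ω => (π t).prob (D.histX t ω) a) * U.indicator fun _ => (1 : ℝ)) P := by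
    refine (hi U hU).bdd_mul (c := 1) (hD.measurable_prob t a).aestronglyMeasurable
      (Eventually.of_forall fun ω => ?_)
    rw [Real.norm_of_nonneg ((π t).nonneg _ _)]
    exact (π t).prob_le_one _ _
  -- Conditioning on history and context, unconfoundedness factors the probability of `A = a` and
  -- `U`; the first factor is the policy, which is measurable for the conditioning and moves back
  -- inside.
  have key : ∫ ω in S, (D.A t ⁻¹' {a} ∩ U).indicator (fun _ => (1 : ℝ)) ω ∂P =
      ∫ ω in S, ((fun ω => (π t).prob (D.histX t ω) a) * U.indicator fun _ => (1 : ℝ)) ω ∂P := by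
    rw [← setIntegral_condExp hle (hi _ (hA.inter hU)) hSm, ← setIntegral_condExp hle hprodi hSm]
    refine integral_congr_ae (ae_restrict_of_ae ?_)
    have h1 := hu t {a} u (measurableSet_singleton a) hu'
    have h2 := hD.selection t a
    have h3 := condExp_mul_of_stronglyMeasurable_left hprob hprodi (hi U hU)
    filter_upwards [h1, h2, h3] with ω h1 h2 h3
    rw [h1, h3, Pi.mul_apply, Pi.mul_apply, h2]
  rw [setIntegral_indicator (hA.inter hU)] at key
  have e : (fun ω => (π t).prob (D.histX t ω) a) * U.indicator (fun _ => (1 : ℝ)) =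
      U.indicator fun ω => (π t).prob (D.histX t ω) a := by
    ext ω
    by_cases h : ω ∈ U <;> simp [h]
  rw [e, setIntegral_indicator hU] at key
  rw [← key]
  simp only [integral_const, smul_eq_mul, mul_one, measureReal_restrict_apply_univ]
  rw [ofReal_measureReal]
  congr 1
  ext ω
  simp only [Set.mem_inter_iff]
  tauto

/-- This form needs no integrability, so it is available before any moment of the potential outcomes
is known to be finite. -/
lemma lintegral_selection (hD : IsBanditExperiment P ν π D) (hu : Unconfounded P D) (t : ℕ)
    (a : Fin K) {F : (History 𝒳 K t × 𝒳) × (Fin K → ℝ) → ENNReal} (hF : Measurable F) :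
    ∫⁻ ω in D.A t ⁻¹' {a}, F (D.histX t ω, fun b => D.Y t b ω) ∂P =
      ∫⁻ ω, ENNReal.ofReal ((π t).prob (D.histX t ω) a) * F (D.histX t ω, fun b => D.Y t b ω) ∂P :=
    by
  have hm := (hD.measurable_histX t).prodMk (measurable_pi_lambda _ (hD.measurable_Y t))
  rw [← lintegral_map hF hm, hD.map_restrict_selection hu t a, lintegral_map hF hm]
  exact lintegral_withDensity_eq_lintegral_mul P (hD.measurable_prob t a).ennreal_ofReal
    (hF.comp hm)

lemma integral_selection {E : Type*} [NormedAddCommGroup E] [NormedSpace ℝ E]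
    (hD : IsBanditExperiment P ν π D) (hu : Unconfounded P D) (t : ℕ)
    (a : Fin K) {F : (History 𝒳 K t × 𝒳) × (Fin K → ℝ) → E} (hF : StronglyMeasurable F) :
    ∫ ω in D.A t ⁻¹' {a}, F (D.histX t ω, fun b => D.Y t b ω) ∂P =
      ∫ ω, (π t).prob (D.histX t ω) a • F (D.histX t ω, fun b => D.Y t b ω) ∂P := by
  have hm := (hD.measurable_histX t).prodMk (measurable_pi_lambda _ (hD.measurable_Y t))
  rw [← integral_map hm.aemeasurable hF.aestronglyMeasurable, hD.map_restrict_selection hu t a,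
    integral_map hm.aemeasurable hF.aestronglyMeasurable,
    integral_withDensity_eq_integral_toReal_smul (hD.measurable_prob t a).ennreal_ofReal
      (Eventually.of_forall fun _ => ENNReal.ofReal_lt_top)]
  simp only [ENNReal.toReal_ofReal ((π t).nonneg _ _)]

lemma isProbabilityMeasure (hD : IsBanditExperiment P ν π D) : IsProbabilityMeasure ν := by
  rw [← (hD.hasLaw 0).map_eq]
  exact Measure.isProbabilityMeasure_map (hD.hasLaw 0).aemeasurable

/-- Fourth moments of the observed outcomes and a lower bound on the sampling probability of an
arm control the fourth moment of the potential outcome of that arm. -/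
lemma integrable_pow_four (hD : IsBanditExperiment P ν π D) (hu : Unconfounded P D)
    (hY4 : Integrable (fun ω => D.Yobs 0 ω ^ 4) P) {a : Fin K} {c : ℝ} (hc : 0 < c)
    (hmin : ∀ᵐ ω ∂P, c ≤ (π 0).prob (D.histX 0 ω) a) :
    Integrable (fun z : 𝒳 × (Fin K → ℝ) => z.2 a ^ 4) ν := by
  refine ⟨by fun_prop, ?_⟩
  rw [hasFiniteIntegral_iff_enorm, ← (hD.hasLaw 0).lintegral_comp (by fun_prop)]
  -- The chain is $c\,E|Y(a)|^4\le E[\pi_0(a)|Y(a)|^4]=E[1_{\{A=a\}}|Y(a)|^4]\le E|Y_{obs}|^4$. One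
  -- time suffices, since the law `ν` is common to all times.
  have h1 := hD.lintegral_selection hu 0 a (F := fun q => ‖q.2 a ^ 4‖ₑ) (by fun_prop)
  have h2 : ENNReal.ofReal c * ∫⁻ ω, ‖D.Y 0 a ω ^ 4‖ₑ ∂P ≤
      ∫⁻ ω, ENNReal.ofReal ((π 0).prob (D.histX 0 ω) a) * ‖D.Y 0 a ω ^ 4‖ₑ ∂P := by
    rw [← lintegral_const_mul _ (by have := hD.measurable_Y 0 a; fun_prop)]
    refine lintegral_mono_ae ?_
    filter_upwards [hmin] with ω hω
    gcongr
  have h3 : ∫⁻ ω in D.A 0 ⁻¹' {a}, ‖D.Y 0 a ω ^ 4‖ₑ ∂P ≤ ∫⁻ ω, ‖D.Yobs 0 ω ^ 4‖ₑ ∂P := by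
    refine le_trans (le_of_eq ?_) (setLIntegral_le_lintegral (D.A 0 ⁻¹' {a}) _)
    refine setLIntegral_congr_fun (hD.measurable_A 0 (measurableSet_singleton a)) fun ω hω => ?_
    have : D.A 0 ω = a := hω
    simp [BanditData.Yobs, this]
  have h4 := (h2.trans (h1.symm.le.trans h3)).trans_lt (hasFiniteIntegral_iff_enorm.1 hY4.2)
  have h5 : ENNReal.ofReal c ≠ 0 := by simpa using hc
  exact (ENNReal.mul_lt_top_iff.1 h4).elim (fun h => h.2) fun h => h.elim (fun h => absurd h h5)
    fun h => by
      change ∫⁻ ω, ‖D.Y 0 a ω ^ 4‖ₑ ∂P < ⊤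
      rw [h]
      exact ENNReal.zero_lt_top

end IsBanditExperiment

end OffPolicy

/-! ### Weighted observations and their law of large numbers. -/

namespace OffPolicy

variable {Ω 𝒳 : Type*} {K : ℕ}

/-- A function of context and observed outcome, restricted to the times at which the arm `a` is
selected and weighted by a power of the inverse selection probability. -/
noncomputable def weightedObs (D : BanditData Ω 𝒳 K) (a : Fin K) (j : ℕ) (h : 𝒳 × ℝ → ℝ) (t : ℕ) (ω : Ω) : ℝ :=
  (if D.A t ω = a then 1 else 0) / D.p t ω ^ (j + 1) * h (D.X t ω, D.Yobs t ω)

/-- The summand of `weightedObs` as a function of the record of a single time. -/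
noncomputable def weightedRecord (a : Fin K) (j : ℕ) (h : 𝒳 × ℝ → ℝ) (r : 𝒳 × ℝ × Fin K × ℝ) : ℝ :=
  (if r.2.2.1 = a then 1 else 0) / r.2.1 ^ (j + 1) * h (r.1, r.2.2.2)

/-- A past weighted observation is thus a function of the history, and can serve as a test function
of the past at time `t`. -/
lemma weightedObs_eq_weightedRecord (D : BanditData Ω 𝒳 K) (a : Fin K) (j : ℕ) (h : 𝒳 × ℝ → ℝ)
    {s t : ℕ} (hst : s < t) (ω : Ω) :
    weightedObs D a j h s ω = weightedRecord a j h (D.hist t ω ⟨s, hst⟩) := rfl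

variable [MeasurableSpace Ω] [MeasurableSpace 𝒳]

lemma measurable_weightedRecord (a : Fin K) (j : ℕ) {h : 𝒳 × ℝ → ℝ} (hh : Measurable h) :
    Measurable (weightedRecord (K := K) a j h) := by
  have h1 : Measurable fun r : 𝒳 × ℝ × Fin K × ℝ => if r.2.2.1 = a then (1 : ℝ) else 0 :=
    Measurable.ite ((measurable_fst.comp (measurable_snd.comp measurable_snd))
      (measurableSet_singleton a)) measurable_const measurable_const
  unfold weightedRecord
  fun_prop

/-- The error of replacing the inverse selection probabilities by those of the limit policy. -/
noncomputable def invProbGap (π : BehaviorPolicy 𝒳 K) (πbar : StochasticPolicy 𝒳 K) (D : BanditData Ω 𝒳 K)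
    (a : Fin K) (j : ℕ) (t : ℕ) (ω : Ω) : ℝ :=
  ((π t).prob (D.histX t ω) a ^ j)⁻¹ - (πbar.prob (D.X t ω) a ^ j)⁻¹

/-- The limit of the averages of `weightedObs`. -/
noncomputable def weightedMean (ν : Measure (𝒳 × (Fin K → ℝ))) (πbar : StochasticPolicy 𝒳 K) (a : Fin K) (j : ℕ)
    (h : 𝒳 × ℝ → ℝ) : ℝ :=
  ∫ z, h (z.1, z.2 a) * (πbar.prob z.1 a ^ j)⁻¹ ∂ν

variable {P : Measure Ω} {ν : Measure (𝒳 × (Fin K → ℝ))} {π : BehaviorPolicy 𝒳 K}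
  {D : BanditData Ω 𝒳 K} {πbar : StochasticPolicy 𝒳 K} {a : Fin K} {c : ℝ}

namespace IsBanditExperiment

lemma measurable_weightedObs (hD : IsBanditExperiment P ν π D) (a : Fin K) (j : ℕ)
    {h : 𝒳 × ℝ → ℝ} (hh : Measurable h) (t : ℕ) : Measurable (weightedObs D a j h t) := by
  rw [funext fun ω => weightedObs_eq_weightedRecord D a j h t.lt_succ_self ω]
  exact (measurable_weightedRecord a j hh).comp
    ((measurable_pi_apply _).comp (hD.measurable_hist (t + 1)))

/-- On the selected event the recorded probability and the observed outcome are those of arm `a`.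
What remains is a function of history, context and potential outcomes, as `integral_selection`
requires. -/
lemma weightedObs_eq_indicator (hD : IsBanditExperiment P ν π D) (a : Fin K) (j : ℕ)
    (h : 𝒳 × ℝ → ℝ) (t : ℕ) :
    weightedObs D a j h t = (D.A t ⁻¹' {a}).indicator fun ω =>
      ((π t).prob (D.histX t ω) a ^ (j + 1))⁻¹ * h (D.X t ω, D.Y t a ω) := by
  ext ω
  by_cases hω : D.A t ω = a
  · rw [Set.indicator_of_mem (s := D.A t ⁻¹' {a}) hω]
    simp [weightedObs, hω, hD.recorded, BanditData.Yobs]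
  · rw [Set.indicator_of_notMem (s := D.A t ⁻¹' {a}) hω]
    simp [weightedObs, hω]

lemma ae_abs_weightedObs_le (hD : IsBanditExperiment P ν π D) (hc : 0 < c)
    (hmin : ∀ t, ∀ᵐ ω ∂P, c ≤ (π t).prob (D.histX t ω) a) (j : ℕ) (h : 𝒳 × ℝ → ℝ) (t : ℕ) :
    ∀ᵐ ω ∂P, |weightedObs D a j h t ω| ≤ (c ^ (j + 1))⁻¹ * |h (D.X t ω, D.Y t a ω)| := by
  rw [hD.weightedObs_eq_indicator]
  filter_upwards [hmin t] with ω hω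
  by_cases hA : ω ∈ D.A t ⁻¹' {a}
  · rw [Set.indicator_of_mem hA, abs_mul, abs_of_nonneg
      (inv_nonneg.2 (pow_nonneg ((π t).nonneg _ _) _))]
    gcongr
  · rw [Set.indicator_of_notMem hA, abs_zero]
    positivity

lemma measurable_invProbGap (hD : IsBanditExperiment P ν π D) (πbar : StochasticPolicy 𝒳 K)
    (a : Fin K) (j t : ℕ) : Measurable (invProbGap π πbar D a j t) :=
  ((hD.measurable_prob t a).pow_const j).inv.sub
    (((πbar.measurable a).comp (hD.measurable_X t)).pow_const j).inv

lemma ae_le_limit_prob_X (hD : IsBanditExperiment P ν π D)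
    (hbar : ∀ᵐ z ∂ν, c ≤ πbar.prob z.1 a) (t : ℕ) : ∀ᵐ ω ∂P, c ≤ πbar.prob (D.X t ω) a := by
  have h := (hD.hasLaw t).map_eq
  rw [← h] at hbar
  exact ae_of_ae_map (hD.hasLaw t).aemeasurable hbar

lemma ae_abs_invProbGap_le (hD : IsBanditExperiment P ν π D) (hc : 0 < c)
    (hmin : ∀ t, ∀ᵐ ω ∂P, c ≤ (π t).prob (D.histX t ω) a) (hbar : ∀ᵐ z ∂ν, c ≤ πbar.prob z.1 a)
    (j t : ℕ) : ∀ᵐ ω ∂P, |invProbGap π πbar D a j t ω| ≤ (c ^ j)⁻¹ := by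
  filter_upwards [hmin t, hD.ae_le_limit_prob_X hbar t] with ω h1 h2
  exact abs_inv_pow_sub_inv_pow_le_inv hc h1 h2 j

lemma tendstoInMeasure_invProbGap (hD : IsBanditExperiment P ν π D) (hc : 0 < c)
    (hmin : ∀ t, ∀ᵐ ω ∂P, c ≤ (π t).prob (D.histX t ω) a) (hbar : ∀ᵐ z ∂ν, c ≤ πbar.prob z.1 a)
    (hconv : PolicyConverges P π D πbar) (j : ℕ) :
    TendstoInMeasure P (invProbGap π πbar D a j) atTop fun _ => 0 := by
  refine tendstoInMeasure_zero_of_ae_abs_le (L := j / (c ^ j * c ^ j)) (hconv a) fun t => ?_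
  filter_upwards [hmin t, hD.ae_le_limit_prob_X hbar t] with ω h1 h2
  exact abs_inv_pow_sub_inv_pow_le hc h1 h2 ((π t).prob_le_one _ _) (πbar.prob_le_one _ _) j

lemma memLp_comp_outcome (hD : IsBanditExperiment P ν π D) {h : 𝒳 × ℝ → ℝ} {q : ENNReal}
    (hL : MemLp (fun z : 𝒳 × (Fin K → ℝ) => h (z.1, z.2 a)) q ν) (t : ℕ) :
    MemLp (fun ω => h (D.X t ω, D.Y t a ω)) q P := by
  rw [← (hD.hasLaw t).map_eq] at hL
  exact hL.comp_of_map (hD.hasLaw t).aemeasurable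

lemma memLp_weightedObs (hD : IsBanditExperiment P ν π D) (hc : 0 < c)
    (hmin : ∀ t, ∀ᵐ ω ∂P, c ≤ (π t).prob (D.histX t ω) a) (j : ℕ) {h : 𝒳 × ℝ → ℝ}
    (hh : Measurable h) {q : ENNReal}
    (hL : MemLp (fun z : 𝒳 × (Fin K → ℝ) => h (z.1, z.2 a)) q ν) (t : ℕ) :
    MemLp (weightedObs D a j h t) q P :=
  (hD.memLp_comp_outcome hL t).of_le_mul (hD.measurable_weightedObs a j hh t).aestronglyMeasurable
    (hD.ae_abs_weightedObs_le hc hmin j h t)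

variable [IsProbabilityMeasure P]

/-- Averaging over the action multiplies by $\pi_t(a)$ and cancels one of the `j + 1` inverse
factors. The case `j = 0` serves the estimator and `j = 1` its variance; `f` is real for the weak
law and complex for characteristic functions. -/
lemma integral_weightedObs_smul {E : Type*} [NormedAddCommGroup E] [NormedSpace ℝ E]
    (hD : IsBanditExperiment P ν π D) (hu : Unconfounded P D) (hc : 0 < c)
    (hmin : ∀ t, ∀ᵐ ω ∂P, c ≤ (π t).prob (D.histX t ω) a) (j : ℕ) {h : 𝒳 × ℝ → ℝ}
    (hh : Measurable h) (t : ℕ) {f : History 𝒳 K t → E} (hf : StronglyMeasurable f) :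
    ∫ ω, weightedObs D a j h t ω • f (D.hist t ω) ∂P =
      ∫ ω, (h (D.X t ω, D.Y t a ω) * ((π t).prob (D.histX t ω) a ^ j)⁻¹) • f (D.hist t ω) ∂P := by
  let F : (History 𝒳 K t × 𝒳) × (Fin K → ℝ) → E := fun q =>
    (((π t).prob q.1 a ^ (j + 1))⁻¹ * h (q.1.2, q.2 a)) • f q.1.1
  have hF : StronglyMeasurable F := by
    refine StronglyMeasurable.smul (Measurable.stronglyMeasurable ?_)
      (hf.comp_measurable (measurable_fst.comp measurable_fst))
    have : Measurable fun q : (History 𝒳 K t × 𝒳) × (Fin K → ℝ) => (π t).prob q.1 a :=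
      ((π t).measurable a).comp measurable_fst
    exact (this.pow_const (j + 1)).inv.mul (hh.comp (by fun_prop))
  have e : ∀ ω, weightedObs D a j h t ω • f (D.hist t ω) =
      (D.A t ⁻¹' {a}).indicator (fun ω => F (D.histX t ω, fun b => D.Y t b ω)) ω := by
    intro ω
    rw [hD.weightedObs_eq_indicator]
    by_cases hA : ω ∈ D.A t ⁻¹' {a}
    · rw [Set.indicator_of_mem hA, Set.indicator_of_mem hA]
      rfl
    · rw [Set.indicator_of_notMem hA, Set.indicator_of_notMem hA, zero_smul]
  simp only [e]
  rw [integral_indicator (hD.measurable_A t (measurableSet_singleton a)),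
    hD.integral_selection hu t a hF]
  refine integral_congr_ae ?_
  filter_upwards [hmin t] with ω hω
  have h0 : (π t).prob (D.histX t ω) a ≠ 0 := (hc.trans_le hω).ne'
  change (π t).prob (D.histX t ω) a • (((π t).prob (D.histX t ω) a ^ (j + 1))⁻¹ *
    h (D.X t ω, D.Y t a ω)) • f (D.hist t ω) = _
  rw [smul_smul]
  congr 1
  field_simp
  ring

/-- The weighted observations are nearly uncorrelated with the past. -/
lemma norm_integral_weightedObs_smul_sub_le {E : Type*} [NormedAddCommGroup E] [NormedSpace ℝ E]
    [MeasurableSpace E] [BorelSpace E]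
    (hD : IsBanditExperiment P ν π D) (hu : Unconfounded P D) (hc : 0 < c)
    (hmin : ∀ t, ∀ᵐ ω ∂P, c ≤ (π t).prob (D.histX t ω) a) (hbar : ∀ᵐ z ∂ν, c ≤ πbar.prob z.1 a)
    (j : ℕ) {h : 𝒳 × ℝ → ℝ} (hh : Measurable h) (t : ℕ) {f : History 𝒳 K t → E}
    (hf : StronglyMeasurable f)
    (hint : Integrable (fun ω => h (D.X t ω, D.Y t a ω) • f (D.hist t ω)) P) :
    ‖∫ ω, weightedObs D a j h t ω • f (D.hist t ω) ∂P -
      weightedMean ν πbar a j h • ∫ ω, f (D.hist t ω) ∂P‖ ≤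
      ∫ ω, |h (D.X t ω, D.Y t a ω)| * |invProbGap π πbar D a j t ω| * ‖f (D.hist t ω)‖ ∂P := by
  have hbarX := hD.ae_le_limit_prob_X hbar t
  have hpm : Measurable fun x => (πbar.prob x a ^ j)⁻¹ := ((πbar.measurable a).pow_const j).inv
  have hkm : Measurable fun z : 𝒳 × (Fin K → ℝ) => h (z.1, z.2 a) * (πbar.prob z.1 a ^ j)⁻¹ :=
    (hh.comp (by fun_prop)).mul (hpm.comp measurable_fst)
  have hbound : ∀ {x : ℝ}, c ≤ x → ‖(x ^ j)⁻¹‖ ≤ (c ^ j)⁻¹ := fun {x} hx => by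
    rw [Real.norm_of_nonneg (inv_nonneg.2 (pow_nonneg (hc.le.trans hx) _))]
    gcongr
  have hi1 : Integrable (fun ω => (h (D.X t ω, D.Y t a ω) *
      ((π t).prob (D.histX t ω) a ^ j)⁻¹) • f (D.hist t ω)) P := by
    refine (hint.bdd_smul (φ := fun ω => ((π t).prob (D.histX t ω) a ^ j)⁻¹) ((c ^ j)⁻¹)
      ((hD.measurable_prob t a).pow_const j).inv.aestronglyMeasurable
      ((hmin t).mono fun ω => hbound)).congr (Eventually.of_forall fun ω => ?_)
    simp only [Pi.smul_apply', smul_smul]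
    rw [mul_comm]
  have hi2 : Integrable (fun ω => (h (D.X t ω, D.Y t a ω) *
      (πbar.prob (D.X t ω) a ^ j)⁻¹) • f (D.hist t ω)) P := by
    refine (hint.bdd_smul (φ := fun ω => (πbar.prob (D.X t ω) a ^ j)⁻¹) ((c ^ j)⁻¹)
      (hpm.comp (hD.measurable_X t)).aestronglyMeasurable
      (hbarX.mono fun ω => hbound)).congr (Eventually.of_forall fun ω => ?_)
    simp only [Pi.smul_apply', smul_smul]
    rw [mul_comm]
  -- With `πbar` in place of $\pi_t$ the first factor depends only on the fresh environment, which
  -- is independent of the history.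
  have hind : ∫ ω, (h (D.X t ω, D.Y t a ω) * (πbar.prob (D.X t ω) a ^ j)⁻¹) • f (D.hist t ω) ∂P =
      weightedMean ν πbar a j h • ∫ ω, f (D.hist t ω) ∂P := by
    have hI := (hD.fresh t).integral_fun_comp_smul_comp (hD.measurable_env t).aemeasurable
      (hD.measurable_hist t).aemeasurable hkm.aestronglyMeasurable hf.aestronglyMeasurable
    rw [show weightedMean ν πbar a j h = _ from
      ((hD.hasLaw t).integral_comp hkm.aestronglyMeasurable).symm]
    exact hI
  rw [hD.integral_weightedObs_smul hu hc hmin j hh t hf, ← hind, ← integral_sub hi1 hi2]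
  refine (norm_integral_le_integral_norm _).trans_eq (integral_congr_ae
    (Eventually.of_forall fun ω => ?_))
  simp only
  rw [← sub_smul, ← mul_sub, norm_smul, norm_mul, Real.norm_eq_abs, Real.norm_eq_abs]
  rfl

lemma integral_sq_weightedObs_sub_le (hD : IsBanditExperiment P ν π D) (hc : 0 < c)
    (hmin : ∀ t, ∀ᵐ ω ∂P, c ≤ (π t).prob (D.histX t ω) a) (j : ℕ) {h : 𝒳 × ℝ → ℝ}
    (hL : MemLp (fun z : 𝒳 × (Fin K → ℝ) => h (z.1, z.2 a)) 2 ν) (m : ℝ) (t : ℕ) :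
    ∫ ω, (weightedObs D a j h t ω - m) ^ 2 ∂P ≤
      2 * ((c ^ (j + 1))⁻¹ ^ 2 * ∫ z, h (z.1, z.2 a) ^ 2 ∂ν) + 2 * m ^ 2 := by
  have h2 := (hD.memLp_comp_outcome hL t).integrable_sq
  have hbd : Integrable (fun ω => 2 * ((c ^ (j + 1))⁻¹ ^ 2 * h (D.X t ω, D.Y t a ω) ^ 2)) P :=
    (h2.const_mul _).const_mul 2
  have hle : ∫ ω, (weightedObs D a j h t ω - m) ^ 2 ∂P ≤
      ∫ ω, (2 * ((c ^ (j + 1))⁻¹ ^ 2 * h (D.X t ω, D.Y t a ω) ^ 2) + 2 * m ^ 2) ∂P := by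
    refine integral_mono_of_nonneg (Eventually.of_forall fun _ => sq_nonneg _)
      (hbd.add (integrable_const _)) ?_
    filter_upwards [hD.ae_abs_weightedObs_le hc hmin j h t] with ω hω
    have h3 := pow_le_pow_left₀ (abs_nonneg _) hω 2
    rw [sq_abs, mul_pow, sq_abs] at h3
    nlinarith [sq_nonneg (weightedObs D a j h t ω + m)]
  rw [integral_add hbd (integrable_const _), integral_const_mul, integral_const_mul] at hle
  have e : ∫ ω, h (D.X t ω, D.Y t a ω) ^ 2 ∂P = ∫ z, h (z.1, z.2 a) ^ 2 ∂ν :=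
    (hD.hasLaw t).integral_comp (f := fun z => h (z.1, z.2 a) ^ 2) (hL.1.pow 2)
  rw [e] at hle
  simpa using hle

/-- Law of large numbers for weighted observations. -/
lemma tendstoInMeasure_average_weightedObs (hD : IsBanditExperiment P ν π D)
    (hu : Unconfounded P D) (hc : 0 < c)
    (hmin : ∀ t, ∀ᵐ ω ∂P, c ≤ (π t).prob (D.histX t ω) a) (hbar : ∀ᵐ z ∂ν, c ≤ πbar.prob z.1 a)
    (hconv : PolicyConverges P π D πbar) (j : ℕ) {h : 𝒳 × ℝ → ℝ} (hh : Measurable h)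
    (hL : MemLp (fun z : 𝒳 × (Fin K → ℝ) => h (z.1, z.2 a)) 2 ν) :
    TendstoInMeasure P (fun (n : ℕ) ω => (1 / (n : ℝ)) *
      ∑ t ∈ Finset.range n, weightedObs D a j h t ω) atTop fun _ => weightedMean ν πbar a j h := by
  set m := weightedMean ν πbar a j h with hm
  set C := 2 * ((c ^ (j + 1))⁻¹ ^ 2 * ∫ z, h (z.1, z.2 a) ^ 2 ∂ν) + 2 * m ^ 2 with hC
  have hsq := hD.integral_sq_weightedObs_sub_le hc hmin j hL m
  have hZ := hD.memLp_weightedObs hc hmin j hh hL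
  let W := invProbGap π πbar D a j
  have hWm := hD.measurable_invProbGap πbar a j
  have hWb := hD.ae_abs_invProbGap_le hc hmin hbar j
  have hgap : Tendsto (fun t => ∫ ω, |h (D.X t ω, D.Y t a ω) ^ 2| * |W t ω * W t ω| ∂P) atTop
      (𝓝 0) := by
    have hW := hD.tendstoInMeasure_invProbGap hc hmin hbar hconv j
    have hW2 := tendstoInMeasure_mul_const hW hW
    rw [mul_zero] at hW2
    refine tendsto_integral_mul_of_tendstoInMeasure (B := (c ^ j)⁻¹ * (c ^ j)⁻¹) hD.hasLaw
      hL.integrable_sq (fun t => ((hWm t).mul (hWm t)).aemeasurable) (fun t => ?_) hW2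
    filter_upwards [hWb t] with ω hω
    rw [abs_mul]
    gcongr
  refine tendstoInMeasure_average hZ hsq
    -- The correlation bound may depend only on the later time `t`: Cauchy–Schwarz separates the
    -- policy gap at `t` from the earlier term, whose second moment is at most `C`.
    (c := fun t => √(∫ ω, |h (D.X t ω, D.Y t a ω) ^ 2| * |W t ω * W t ω| ∂P) * √C)
    (fun s t hst => ?_) (fun t => by positivity) ?_
  · have hf : Measurable fun H : History 𝒳 K t => weightedRecord a j h (H ⟨s, hst⟩) - m :=
      ((measurable_weightedRecord a j hh).comp (measurable_pi_apply _)).sub_const m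
    have hZs : MemLp (fun ω => weightedObs D a j h s ω - m) 2 P := (hZ s).sub (memLp_const m)
    have hht := hD.memLp_comp_outcome hL t
    have hkey := hD.norm_integral_weightedObs_smul_sub_le hu hc hmin hbar j hh t
      hf.stronglyMeasurable (hht.integrable_mul hZs)
    simp only [smul_eq_mul, ← weightedObs_eq_weightedRecord] at hkey
    have hhW : MemLp (fun ω => h (D.X t ω, D.Y t a ω) * W t ω) 2 P := by
      refine hht.of_le_mul (c := (c ^ j)⁻¹) (hht.1.mul (hWm t).aestronglyMeasurable) ?_
      filter_upwards [hWb t] with ω hω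
      rw [norm_mul, mul_comm]
      gcongr
      exact hω
    -- Here $Z_s-m$ is the test function of the past, so the covariance is exactly the difference
    -- estimated in `hkey`.
    have e1 : ∫ ω, (weightedObs D a j h s ω - m) * (weightedObs D a j h t ω - m) ∂P =
        ∫ ω, weightedObs D a j h t ω * (weightedObs D a j h s ω - m) ∂P -
          m * ∫ ω, (weightedObs D a j h s ω - m) ∂P := by
      have hp : Integrable (fun ω => weightedObs D a j h t ω * (weightedObs D a j h s ω - m)) P :=
        (hZ t).integrable_mul hZs
      rw [← integral_const_mul, ← integral_sub hp
        ((hZs.integrable (by norm_num)).const_mul m)]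
      refine integral_congr_ae (Eventually.of_forall fun ω => ?_)
      simp only
      ring
    rw [e1]
    refine ((le_abs_self _).trans hkey).trans ?_
    have h4 := integral_mul_le_sqrt_mul_sqrt hhW hZs
    have e2 : ∀ ω, (h (D.X t ω, D.Y t a ω) * W t ω) ^ 2 =
        |h (D.X t ω, D.Y t a ω) ^ 2| * |W t ω * W t ω| := fun ω => by
      rw [abs_of_nonneg (sq_nonneg _), abs_of_nonneg (mul_self_nonneg _)]
      ring
    simp only [abs_mul (h _), e2] at h4
    refine h4.trans ?_
    gcongr
    exact hsq s
  · simpa using (Real.continuous_sqrt.tendsto' 0 0 Real.sqrt_zero).comp hgap |>.mul_const (√C)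

end IsBanditExperiment

end OffPolicy

/-! ### Central limit theorem for inverse probability weighted sums. -/

lemma memLp_four_iff_integrable_pow {α : Type*} [MeasurableSpace α] {μ : Measure α} {f : α → ℝ}
    (hf : AEStronglyMeasurable f μ) : MemLp f 4 μ ↔ Integrable (fun x => f x ^ 4) μ := by
  rw [← integrable_norm_rpow_iff hf (by norm_num) (by norm_num)]
  refine integrable_congr (Eventually.of_forall fun x => ?_)
  simp only [ENNReal.toReal_ofNat, Real.rpow_ofNat, Real.norm_eq_abs]
  exact (show Even 4 by decide).pow_abs _

namespace OffPolicy

variable {Ω 𝒳 : Type*} {K : ℕ}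

section Algebra

/-- Only one arm is selected at each time. This is why no covariances between arms enter the
asymptotic variance. -/
lemma weightedObs_mul_weightedObs (D : BanditData Ω 𝒳 K) {a b : Fin K} (hab : a ≠ b) (i j : ℕ)
    (h k : 𝒳 × ℝ → ℝ) (t : ℕ) (ω : Ω) : weightedObs D a i h t ω * weightedObs D b j k t ω = 0 := by
  by_cases ha : D.A t ω = a
  · have hb : D.A t ω ≠ b := fun hb => hab (ha.symm.trans hb)
    simp [weightedObs, hb]
  · simp [weightedObs, ha]

/-- The indicator is idempotent and the inverse weight gets squared, which raises `j` from `0` to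
`1`. -/
lemma weightedObs_zero_sq (D : BanditData Ω 𝒳 K) (a : Fin K) (h : 𝒳 × ℝ → ℝ) (t : ℕ) (ω : Ω) :
    weightedObs D a 0 h t ω ^ 2 = weightedObs D a 1 (fun q => h q ^ 2) t ω := by
  by_cases ha : D.A t ω = a
  · simp only [weightedObs, ha, if_true]
    ring
  · simp [weightedObs, ha]

lemma sum_weightedObs_zero_sq (D : BanditData Ω 𝒳 K) (h : Fin K → 𝒳 × ℝ → ℝ) (t : ℕ) (ω : Ω) :
    (∑ a, weightedObs D a 0 (h a) t ω) ^ 2 =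
      ∑ a, weightedObs D a 1 (fun q => h a q ^ 2) t ω := by
  rw [sq, Finset.sum_mul_sum]
  refine Finset.sum_congr rfl fun a _ => ?_
  rw [Finset.sum_eq_single a, ← sq, weightedObs_zero_sq]
  · exact fun b _ hb => weightedObs_mul_weightedObs D hb.symm _ _ _ _ t ω
  · simp

end Algebra

variable [MeasurableSpace Ω] [MeasurableSpace 𝒳]
  {P : Measure Ω} [IsProbabilityMeasure P] {ν : Measure (𝒳 × (Fin K → ℝ))} {π : BehaviorPolicy 𝒳 K}
  {D : BanditData Ω 𝒳 K} {πbar : StochasticPolicy 𝒳 K} {a : Fin K} {c : ℝ}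

namespace IsBanditExperiment

/-- Inverse probability weighting is unbiased given the past. -/
lemma integral_weightedObs_zero_smul {E : Type*} [NormedAddCommGroup E] [NormedSpace ℝ E]
    [MeasurableSpace E] [BorelSpace E]
    (hD : IsBanditExperiment P ν π D) (hu : Unconfounded P D) (hc : 0 < c)
    (hmin : ∀ t, ∀ᵐ ω ∂P, c ≤ (π t).prob (D.histX t ω) a) {h : 𝒳 × ℝ → ℝ} (hh : Measurable h)
    (t : ℕ) {f : History 𝒳 K t → E} (hf : StronglyMeasurable f) :
    ∫ ω, weightedObs D a 0 h t ω • f (D.hist t ω) ∂P =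
      (∫ z, h (z.1, z.2 a) ∂ν) • ∫ ω, f (D.hist t ω) ∂P := by
  rw [hD.integral_weightedObs_smul hu hc hmin 0 hh t hf]
  have hkm : Measurable fun z : 𝒳 × (Fin K → ℝ) => h (z.1, z.2 a) := hh.comp (by fun_prop)
  have hI := (hD.fresh t).integral_fun_comp_smul_comp (hD.measurable_env t).aemeasurable
    (hD.measurable_hist t).aemeasurable hkm.aestronglyMeasurable hf.aestronglyMeasurable
  have e : ∫ ω, h (D.X t ω, D.Y t a ω) ∂P = ∫ z, h (z.1, z.2 a) ∂ν :=
    (hD.hasLaw t).integral_comp hkm.aestronglyMeasurable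
  rw [← e]
  simp only [pow_zero, inv_one, mul_one]
  exact hI

/-- For a bounded test function mere integrability of `h` is enough, and the error no longer depends
on `f`. Applied to characters of the past, it is uniform in the frequency. -/
lemma norm_integral_weightedObs_smul_sub_le_of_norm_le_one {E : Type*} [NormedAddCommGroup E]
    [NormedSpace ℝ E] [MeasurableSpace E] [BorelSpace E]
    (hD : IsBanditExperiment P ν π D) (hu : Unconfounded P D) (hc : 0 < c)
    (hmin : ∀ t, ∀ᵐ ω ∂P, c ≤ (π t).prob (D.histX t ω) a) (hbar : ∀ᵐ z ∂ν, c ≤ πbar.prob z.1 a)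
    (j : ℕ) {h : 𝒳 × ℝ → ℝ} (hh : Measurable h)
    (hL : Integrable (fun z : 𝒳 × (Fin K → ℝ) => h (z.1, z.2 a)) ν) (t : ℕ)
    {f : History 𝒳 K t → E} (hf : StronglyMeasurable f) (hf1 : ∀ H, ‖f H‖ ≤ 1) :
    ‖∫ ω, weightedObs D a j h t ω • f (D.hist t ω) ∂P -
      weightedMean ν πbar a j h • ∫ ω, f (D.hist t ω) ∂P‖ ≤
      ∫ ω, |h (D.X t ω, D.Y t a ω)| * |invProbGap π πbar D a j t ω| ∂P := by
  have hi : Integrable (fun ω => h (D.X t ω, D.Y t a ω)) P :=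
    memLp_one_iff_integrable.1 (hD.memLp_comp_outcome (memLp_one_iff_integrable.2 hL) t)
  have hfm : AEStronglyMeasurable (fun ω => f (D.hist t ω)) P :=
    (hf.comp_measurable (hD.measurable_hist t)).aestronglyMeasurable
  refine (hD.norm_integral_weightedObs_smul_sub_le hu hc hmin hbar j hh t hf
    (hi.smul_bdd 1 hfm (Eventually.of_forall fun ω => hf1 _))).trans ?_
  have hWi : Integrable (fun ω => |h (D.X t ω, D.Y t a ω)| * |invProbGap π πbar D a j t ω|) P := by
    refine hi.abs.mul_bdd (c := (c ^ j)⁻¹)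
      (hD.measurable_invProbGap πbar a j t).aestronglyMeasurable.norm ?_
    filter_upwards [hD.ae_abs_invProbGap_le hc hmin hbar j t] with ω hω
    simpa using hω
  refine integral_mono_of_nonneg (Eventually.of_forall fun _ => by positivity) hWi
    (Eventually.of_forall fun ω => ?_)
  exact mul_le_of_le_one_right (by positivity) (hf1 _)

/-- Central limit theorem for sums of inverse probability weighted centered outcomes. -/
lemma tendstoInDistribution_sum_weightedObs (hD : IsBanditExperiment P ν π D)
    (hu : Unconfounded P D) {c : Fin K → ℝ} (hc : ∀ a, 0 < c a)
    (hmin : ∀ a t, ∀ᵐ ω ∂P, c a ≤ (π t).prob (D.histX t ω) a)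
    (hbar : ∀ a, ∀ᵐ z ∂ν, c a ≤ πbar.prob z.1 a)
    (hconv : PolicyConverges P π D πbar) {h : Fin K → 𝒳 × ℝ → ℝ} (hh : ∀ a, Measurable (h a))
    (hL : ∀ a, MemLp (fun z : 𝒳 × (Fin K → ℝ) => h a (z.1, z.2 a)) 4 ν)
    (h0 : ∀ a, ∫ z, h a (z.1, z.2 a) ∂ν = 0) :
    TendstoInDistribution (fun (n : ℕ) ω => (√(n : ℝ))⁻¹ *
      ∑ t ∈ Finset.range n, ∑ a, weightedObs D a 0 (h a) t ω) atTop id (fun _ => P)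
      (gaussianReal 0 (∑ a, weightedMean ν πbar a 1 fun q => h a q ^ 2).toNNReal) := by
  have := hD.isProbabilityMeasure
  have h1m : ∀ a, Measurable fun q => h a q ^ 2 := fun a => (hh a).pow_const 2
  have hL2 : ∀ a, Integrable (fun z : 𝒳 × (Fin K → ℝ) => h a (z.1, z.2 a) ^ 2) ν := fun a =>
    ((hL a).mono_exponent (by norm_num)).integrable_sq
  have hξ4 : ∀ t, MemLp (fun ω => ∑ a, weightedObs D a 0 (h a) t ω) 4 P := fun t =>
    memLp_finsetSum _ fun a _ => hD.memLp_weightedObs (hc a) (hmin a) 0 (hh a) (hL a) t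
  -- `B` at the environment of time `t` dominates the increment almost surely; its law does not
  -- depend on `t`, so third moments are uniformly bounded.
  let B : 𝒳 × (Fin K → ℝ) → ℝ := fun z => ∑ a, (c a ^ (0 + 1))⁻¹ * |h a (z.1, z.2 a)|
  have hB0 : ∀ z, 0 ≤ B z := fun z => Finset.sum_nonneg fun a _ =>
    mul_nonneg (inv_nonneg.2 (pow_nonneg (hc a).le _)) (abs_nonneg _)
  have hB3 : Integrable (fun z => B z ^ 3) ν := by
    have hB : MemLp B 4 ν := memLp_finsetSum _ fun a _ => (hL a).abs.const_mul _
    refine ((hB.mono_exponent (p := (3 : ℕ)) (by norm_num)).integrable_norm_pow (by norm_num)).congr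
      (Eventually.of_forall fun z => ?_)
    simp only
    rw [Real.norm_of_nonneg (hB0 z)]
  -- The character of the partial sum, written as a function of the history so that the conditional
  -- identities apply to it.
  let past : (t : ℕ) → ℝ → History 𝒳 K t → ℂ := fun t s H => Complex.exp (s *
    (∑ k : Fin t, ∑ a, weightedRecord a 0 (h a) (H k) : ℝ) * Complex.I)
  have hpast : ∀ (t : ℕ) (s : ℝ) (ω : Ω), Complex.exp (s * (∑ k ∈ Finset.range t,
      ∑ a, weightedObs D a 0 (h a) k ω : ℝ) * Complex.I) = past t s (D.hist t ω) := by
    intro t s ω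
    simp only [past]
    rw [Finset.sum_range]
    rfl
  have hpastm : ∀ t s, StronglyMeasurable (past t s) := fun t s => by
    have : Measurable fun H : History 𝒳 K t => ∑ k : Fin t, ∑ a, weightedRecord a 0 (h a) (H k) :=
      Finset.measurable_fun_sum _ fun k _ => Finset.measurable_fun_sum _ fun a _ =>
        (measurable_weightedRecord a 0 (hh a)).comp (measurable_pi_apply k)
    exact Measurable.stronglyMeasurable (by fun_prop)
  have hpast1 : ∀ t s H, ‖past t s H‖ ≤ 1 := fun t s H => by
    simp only [past]
    rw [← Complex.ofReal_mul, Complex.norm_exp_ofReal_mul_I]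
  have hpi : ∀ a j (k : 𝒳 × ℝ → ℝ) t s, Measurable k →
      Integrable (fun z : 𝒳 × (Fin K → ℝ) => k (z.1, z.2 a)) ν →
      Integrable (fun ω => weightedObs D a j k t ω • past t s (D.hist t ω)) P := by
    intro a j k t s hk hki
    have hi := memLp_one_iff_integrable.1
      (hD.memLp_weightedObs (hc a) (hmin a) j hk (memLp_one_iff_integrable.2 hki) t)
    exact hi.smul_bdd 1 ((hpastm t s).comp_measurable (hD.measurable_hist t)).aestronglyMeasurable
      (Eventually.of_forall fun ω => hpast1 _ _ _)
  refine tendstoInDistribution_inv_sqrt_mul_sum_of_orthogonal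
    (ξ := fun t ω => ∑ a, weightedObs D a 0 (h a) t ω) (C := ∫ z, B z ^ 3 ∂ν)
    (c := fun t => ∑ a, ∫ ω, |h a (D.X t ω, D.Y t a ω) ^ 2| * |invProbGap π πbar D a 1 t ω| ∂P)
    (fun t => Finset.measurable_fun_sum _ fun a _ => hD.measurable_weightedObs a 0 (hh a) t)
    (fun t => ?_) (fun t => ?_) ?_ ?_ (fun t s => ?_) (fun t s => ?_)
  · exact ((hξ4 t).mono_exponent (p := (3 : ℕ)) (by norm_num)).integrable_norm_pow (by norm_num)
  · have e : ∫ ω, B (D.env t ω) ^ 3 ∂P = ∫ z, B z ^ 3 ∂ν := (hD.hasLaw t).integral_comp hB3.1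
    have hBi : Integrable (fun ω => B (D.env t ω) ^ 3) P := by
      have := hB3
      rw [← (hD.hasLaw t).map_eq] at this
      exact this.comp_aemeasurable (hD.hasLaw t).aemeasurable
    rw [← e]
    refine integral_mono_of_nonneg (Eventually.of_forall fun _ => by positivity) hBi ?_
    have hall : ∀ᵐ ω ∂P, ∀ a, |weightedObs D a 0 (h a) t ω| ≤
        (c a ^ (0 + 1))⁻¹ * |h a (D.X t ω, D.Y t a ω)| :=
      ae_all_iff.2 fun a => hD.ae_abs_weightedObs_le (hc a) (hmin a) 0 (h a) t
    filter_upwards [hall] with ω hω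
    have : |∑ a, weightedObs D a 0 (h a) t ω| ≤ B (D.env t ω) :=
      (Finset.abs_sum_le_sum_abs _ _).trans (Finset.sum_le_sum fun a _ => hω a)
    exact pow_le_pow_left₀ (abs_nonneg _) this 3
  · exact Finset.sum_nonneg fun a _ => integral_nonneg fun z =>
      mul_nonneg (sq_nonneg _) (inv_nonneg.2 (pow_nonneg (πbar.nonneg _ _) _))
  · rw [← Finset.sum_const_zero (s := (Finset.univ : Finset (Fin K)))]
    refine tendsto_finsetSum _ fun a _ => ?_
    exact tendsto_integral_mul_of_tendstoInMeasure
      (H := fun z : 𝒳 × (Fin K → ℝ) => h a (z.1, z.2 a) ^ 2) hD.hasLaw (hL2 a)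
      (fun t => (hD.measurable_invProbGap πbar a 1 t).aemeasurable)
      (hD.ae_abs_invProbGap_le (hc a) (hmin a) (hbar a) 1)
      (hD.tendstoInMeasure_invProbGap (hc a) (hmin a) (hbar a) hconv 1)
  · simp only [hpast, Finset.sum_smul]
    rw [integral_finsetSum _ fun a _ => hpi a 0 (h a) t s (hh a)
      ((hL a).integrable (by norm_num))]
    refine Finset.sum_eq_zero fun a _ => ?_
    rw [hD.integral_weightedObs_zero_smul hu (hc a) (hmin a) (hh a) t (hpastm t s), h0 a, zero_smul]
  · simp only [hpast, sum_weightedObs_zero_sq, Finset.sum_smul]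
    rw [integral_finsetSum _ fun a _ => hpi a 1 (fun q => h a q ^ 2) t s (h1m a) (hL2 a),
      ← Finset.sum_sub_distrib]
    refine (norm_sum_le _ _).trans (Finset.sum_le_sum fun a _ => ?_)
    exact hD.norm_integral_weightedObs_smul_sub_le_of_norm_le_one hu (hc a) (hmin a) (hbar a) 1
      (h1m a) (hL2 a) t (hpastm t s) (hpast1 t s)

/-- The normalized sums of inverse probability weighted centered outcomes are bounded in `L²`. -/
lemma integral_sq_inv_sqrt_mul_sum_weightedObs_le (hD : IsBanditExperiment P ν π D)
    (hu : Unconfounded P D) (hc : 0 < c)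
    (hmin : ∀ t, ∀ᵐ ω ∂P, c ≤ (π t).prob (D.histX t ω) a) {h : 𝒳 × ℝ → ℝ} (hh : Measurable h)
    (hL : MemLp (fun z : 𝒳 × (Fin K → ℝ) => h (z.1, z.2 a)) 2 ν)
    (h0 : ∫ z, h (z.1, z.2 a) ∂ν = 0) (n : ℕ) :
    ∫ ω, ((√(n : ℝ))⁻¹ * ∑ t ∈ Finset.range n, weightedObs D a 0 h t ω) ^ 2 ∂P ≤
      2 * ((c ^ (0 + 1))⁻¹ ^ 2 * ∫ z, h (z.1, z.2 a) ^ 2 ∂ν) := by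
  set C := 2 * ((c ^ (0 + 1))⁻¹ ^ 2 * ∫ z, h (z.1, z.2 a) ^ 2 ∂ν) with hC
  have hC0 : 0 ≤ C := mul_nonneg zero_le_two
    (mul_nonneg (sq_nonneg _) (integral_nonneg fun _ => sq_nonneg _))
  have hsum : ∫ ω, (∑ t ∈ Finset.range n, weightedObs D a 0 h t ω) ^ 2 ∂P ≤
      -- Centered terms with `j = 0` are exactly orthogonal, so the correlation bound is `0`.
      ∑ t ∈ Finset.range n, (2 * (t * (0 : ℝ)) + C) := by
    refine integral_sq_sum_le (hD.memLp_weightedObs hc hmin 0 hh hL) (fun t => ?_)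
      (fun s t hst => le_of_eq ?_) n
    · simpa [hC] using hD.integral_sq_weightedObs_sub_le hc hmin 0 hL 0 t
    · have hf := ((measurable_weightedRecord a 0 hh).comp
        (measurable_pi_apply (X := fun _ : Fin t => 𝒳 × ℝ × Fin K × ℝ) ⟨s, hst⟩)).stronglyMeasurable
      have := hD.integral_weightedObs_zero_smul hu hc hmin hh t hf
      rw [h0, zero_smul] at this
      rw [← this]
      refine integral_congr_ae (Eventually.of_forall fun ω => ?_)
      exact mul_comm _ _
  simp only [mul_pow]
  rw [integral_const_mul, inv_pow, Real.sq_sqrt (Nat.cast_nonneg _)]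
  rcases Nat.eq_zero_or_pos n with rfl | hn
  · simpa using hC0
  · have hn' : (0 : ℝ) < n := by exact_mod_cast hn
    rw [inv_mul_le_iff₀ hn']
    simpa using hsum

end IsBanditExperiment

end OffPolicy

/-! ### From weighted averages to the estimators. -/

namespace OffPolicy

variable {Ω 𝒳 : Type*} {K : ℕ}

/-- The average of the weighted observations over the first `n` times. -/
noncomputable def weightedAvg (D : BanditData Ω 𝒳 K) (a : Fin K) (j : ℕ) (h : 𝒳 × ℝ → ℝ) (n : ℕ) (ω : Ω) : ℝ :=
  (1 / (n : ℝ)) * ∑ t ∈ Finset.range n, weightedObs D a j h t ω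

lemma weightMean_eq_weightedAvg (D : BanditData Ω 𝒳 K) (n : ℕ) (a : Fin K) (ω : Ω) :
    weightMean D n a ω = weightedAvg D a 0 (fun _ => 1) n ω := by
  simp [weightMean, weightedAvg, weightedObs]

lemma inv_sqrt_mul_sum_weightedObs_sub (D : BanditData Ω 𝒳 K) (a : Fin K) (h : 𝒳 × ℝ → ℝ) (θ : ℝ)
    (n : ℕ) (ω : Ω) :
    (√(n : ℝ))⁻¹ * ∑ t ∈ Finset.range n, weightedObs D a 0 (fun q => h q - θ) t ω =
      √(n : ℝ) * (weightedAvg D a 0 h n ω - θ * weightedAvg D a 0 (fun _ => 1) n ω) := by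
  have e : (√(n : ℝ))⁻¹ = √(n : ℝ) * (1 / (n : ℝ)) := by
    rw [mul_one_div, Real.sqrt_div_self]
  rw [e, mul_assoc]
  congr 1
  simp only [weightedAvg]
  rw [mul_left_comm, ← mul_sub, Finset.mul_sum (a := θ), ← Finset.sum_sub_distrib]
  congr 1
  refine Finset.sum_congr rfl fun t _ => ?_
  simp only [weightedObs]
  ring

variable [MeasurableSpace 𝒳]

/-- The outcome of the arm `a` weighted by the target policy. -/
noncomputable def targetOutcome (πe : StochasticPolicy 𝒳 K) (a : Fin K) (q : 𝒳 × ℝ) : ℝ := πe.prob q.1 a * q.2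

lemma measurable_targetOutcome (πe : StochasticPolicy 𝒳 K) (a : Fin K) :
    Measurable (targetOutcome πe a) :=
  ((πe.measurable a).comp measurable_fst).mul measurable_snd

lemma armEstimator_eq_weightedAvg (πe : StochasticPolicy 𝒳 K) (D : BanditData Ω 𝒳 K) (n : ℕ)
    (a : Fin K) (ω : Ω) : armEstimator πe D n a ω =
      (weightedAvg D a 0 (fun _ => 1) n ω)⁻¹ * weightedAvg D a 0 (targetOutcome πe a) n ω := by
  rw [← weightMean_eq_weightedAvg]
  simp [armEstimator, weightedAvg, weightedObs, targetOutcome]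

/-- Each residual involves an estimator that depends on the whole sample. Expanding the square pulls
it out and leaves three averages governed by the weak law. -/
lemma residualMean_eq_weightedAvg (πe : StochasticPolicy 𝒳 K) (D : BanditData Ω 𝒳 K) (n : ℕ)
    (a : Fin K) (ω : Ω) : residualMean πe D n a ω =
      weightedAvg D a 1 (fun q => targetOutcome πe a q ^ 2) n ω +
        ((-2 * armEstimator πe D n a ω) * weightedAvg D a 1 (targetOutcome πe a) n ω +
          armEstimator πe D n a ω ^ 2 * weightedAvg D a 1 (fun _ => 1) n ω) := by
  simp only [residualMean, weightedAvg]
  rw [mul_left_comm, mul_left_comm (armEstimator πe D n a ω ^ 2), ← mul_add, ← mul_add,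
    Finset.mul_sum (a := -2 * _), Finset.mul_sum (a := _ ^ 2), ← Finset.sum_add_distrib,
    ← Finset.sum_add_distrib]
  congr 1
  refine Finset.sum_congr rfl fun t _ => ?_
  simp only [weightedObs, targetOutcome]
  ring

variable [MeasurableSpace Ω] {P : Measure Ω}
  {ν : Measure (𝒳 × (Fin K → ℝ))} {π : BehaviorPolicy 𝒳 K}
  {D : BanditData Ω 𝒳 K} {πe πbar : StochasticPolicy 𝒳 K} {a : Fin K} {c : ℝ}

lemma memLp_targetOutcome (hY : Integrable (fun z : 𝒳 × (Fin K → ℝ) => z.2 a ^ 4) ν) :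
    MemLp (fun z : 𝒳 × (Fin K → ℝ) => targetOutcome πe a (z.1, z.2 a)) 4 ν := by
  have h : MemLp (fun z : 𝒳 × (Fin K → ℝ) => z.2 a) 4 ν :=
    (memLp_four_iff_integrable_pow (by fun_prop)).2 hY
  have hm : Measurable fun z : 𝒳 × (Fin K → ℝ) => targetOutcome πe a (z.1, z.2 a) :=
    (measurable_targetOutcome πe a).comp (by fun_prop)
  refine h.of_le hm.aestronglyMeasurable (Eventually.of_forall fun z => ?_)
  rw [targetOutcome, norm_mul, Real.norm_of_nonneg (πe.nonneg _ _)]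
  exact mul_le_of_le_one_left (norm_nonneg _) (πe.prob_le_one _ _)

lemma integrable_mul_inv_prob (hc : 0 < c) (hbar : ∀ᵐ z ∂ν, c ≤ πbar.prob z.1 a)
    {k : 𝒳 × (Fin K → ℝ) → ℝ} (hk : Integrable k ν) :
    Integrable (fun z => k z * (πbar.prob z.1 a ^ 1)⁻¹) ν := by
  refine hk.mul_bdd (c := c⁻¹)
    (((πbar.measurable a).comp measurable_fst).pow_const 1).inv.aestronglyMeasurable ?_
  filter_upwards [hbar] with z hz
  rw [pow_one, Real.norm_of_nonneg (inv_nonneg.2 (hc.le.trans hz))]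
  gcongr

/-- The limits of the three averages in the expanded residual mean recombine into a square. -/
lemma integral_armVarIntegrand [IsFiniteMeasure ν] (hc : 0 < c)
    (hbar : ∀ᵐ z ∂ν, c ≤ πbar.prob z.1 a)
    (hL : MemLp (fun z : 𝒳 × (Fin K → ℝ) => targetOutcome πe a (z.1, z.2 a)) 2 ν) :
    weightedMean ν πbar a 1 (fun q => targetOutcome πe a q ^ 2) +
      ((-2 * armTarget ν πe a) * weightedMean ν πbar a 1 (targetOutcome πe a) +
        armTarget ν πe a ^ 2 * weightedMean ν πbar a 1 fun _ => 1) =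
      ∫ z, armVarIntegrand ν πe πbar a z ∂ν := by
  have h0 := integrable_mul_inv_prob hc hbar hL.integrable_sq
  have h1 := (integrable_mul_inv_prob hc hbar (hL.integrable (by norm_num))).const_mul
    (-2 * armTarget ν πe a)
  have h2 := (integrable_mul_inv_prob hc hbar (integrable_const (1 : ℝ))).const_mul
    (armTarget ν πe a ^ 2)
  have h12 := h1.add h2
  simp only [weightedMean]
  rw [← integral_const_mul, ← integral_const_mul, ← integral_add h1 h2]
  refine (integral_add h0 h12).symm.trans ?_
  refine integral_congr_ae (Eventually.of_forall fun z => ?_)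
  simp only [Pi.add_apply, armVarIntegrand, targetOutcome]
  ring

namespace IsBanditExperiment

lemma measurable_weightedAvg (hD : IsBanditExperiment P ν π D) (a : Fin K) (j : ℕ)
    {h : 𝒳 × ℝ → ℝ} (hh : Measurable h) (n : ℕ) : Measurable (weightedAvg D a j h n) :=
  (Finset.measurable_fun_sum _ fun t _ => hD.measurable_weightedObs a j hh t).const_mul _

lemma measurable_armEstimator (hD : IsBanditExperiment P ν π D) (n : ℕ) (a : Fin K) :
    Measurable (armEstimator πe D n a) := by
  rw [funext fun ω => armEstimator_eq_weightedAvg πe D n a ω]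
  exact (hD.measurable_weightedAvg a 0 measurable_const n).inv.mul
    (hD.measurable_weightedAvg a 0 (measurable_targetOutcome πe a) n)

variable [IsProbabilityMeasure P]

lemma tendstoInMeasure_weightedAvg_one (hD : IsBanditExperiment P ν π D)
    (hu : Unconfounded P D) (hc : 0 < c)
    (hmin : ∀ t, ∀ᵐ ω ∂P, c ≤ (π t).prob (D.histX t ω) a) (hbar : ∀ᵐ z ∂ν, c ≤ πbar.prob z.1 a)
    (hconv : PolicyConverges P π D πbar) :
    TendstoInMeasure P (weightedAvg D a 0 fun _ => 1) atTop fun _ => 1 := by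
  have := hD.isProbabilityMeasure
  have h := hD.tendstoInMeasure_average_weightedObs hu hc hmin hbar hconv 0
    (h := fun _ => 1) measurable_const (memLp_const 1)
  have e : weightedMean ν πbar a 0 (fun _ => 1) = 1 := by simp [weightedMean]
  rw [e] at h
  exact h

/-- Consistency of the arm estimator. -/
lemma tendstoInMeasure_armEstimator (hD : IsBanditExperiment P ν π D)
    (hu : Unconfounded P D) (hc : 0 < c)
    (hmin : ∀ t, ∀ᵐ ω ∂P, c ≤ (π t).prob (D.histX t ω) a) (hbar : ∀ᵐ z ∂ν, c ≤ πbar.prob z.1 a)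
    (hconv : PolicyConverges P π D πbar)
    (hL : MemLp (fun z : 𝒳 × (Fin K → ℝ) => targetOutcome πe a (z.1, z.2 a)) 2 ν) :
    TendstoInMeasure P (fun n ω => armEstimator πe D n a ω) atTop fun _ => armTarget ν πe a := by
  have hG := tendstoInMeasure_comp_continuousAt
    (hD.tendstoInMeasure_weightedAvg_one hu hc hmin hbar hconv) (continuousAt_inv₀ one_ne_zero)
  have hN := hD.tendstoInMeasure_average_weightedObs hu hc hmin hbar hconv 0
    (measurable_targetOutcome πe a) hL
  have h := tendstoInMeasure_mul_const hG hN
  have e : weightedMean ν πbar a 0 (targetOutcome πe a) = armTarget ν πe a := by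
    simp [weightedMean, armTarget, targetOutcome]
  rw [e, inv_one, one_mul] at h
  exact h.congr_left fun n =>
    Eventually.of_forall fun ω => (armEstimator_eq_weightedAvg πe D n a ω).symm

/-- Consistency of the variance estimator of an arm. -/
lemma tendstoInMeasure_armVarEstimator (hD : IsBanditExperiment P ν π D)
    (hu : Unconfounded P D) (hc : 0 < c)
    (hmin : ∀ t, ∀ᵐ ω ∂P, c ≤ (π t).prob (D.histX t ω) a) (hbar : ∀ᵐ z ∂ν, c ≤ πbar.prob z.1 a)
    (hconv : PolicyConverges P π D πbar)
    (hL : MemLp (fun z : 𝒳 × (Fin K → ℝ) => targetOutcome πe a (z.1, z.2 a)) 4 ν) :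
    TendstoInMeasure P (fun n ω => ((weightMean D n a ω) ^ 2)⁻¹ * residualMean πe D n a ω) atTop
      fun _ => ∫ z, armVarIntegrand ν πe πbar a z ∂ν := by
  have := hD.isProbabilityMeasure
  have hL2 := hL.mono_exponent (p := 2) (by norm_num)
  have hm := measurable_targetOutcome πe a
  -- The weak law needs the squared outcome in $L^2$: this uses the fourth moment in full.
  have hLsq : MemLp (fun z : 𝒳 × (Fin K → ℝ) => targetOutcome πe a (z.1, z.2 a) ^ 2) 2 ν := by
    refine (memLp_two_iff_integrable_sq (hL.1.pow 2)).2 ?_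
    refine ((memLp_four_iff_integrable_pow hL.1).1 hL).congr (Eventually.of_forall fun z => ?_)
    simp only [Pi.pow_apply]
    ring
  have hGc : ContinuousAt (fun x : ℝ => (x ^ 2)⁻¹) 1 :=
    (continuousAt_id.pow 2).inv₀ (by norm_num)
  have hG := tendstoInMeasure_comp_continuousAt
    (hD.tendstoInMeasure_weightedAvg_one hu hc hmin hbar hconv) hGc
  have hθ := hD.tendstoInMeasure_armEstimator hu hc hmin hbar hconv hL2
  have hθ1 := tendstoInMeasure_comp_continuousAt (g := fun x : ℝ => -2 * x) hθ (by fun_prop)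
  have hθ2 := tendstoInMeasure_comp_continuousAt (g := fun x : ℝ => x ^ 2) hθ (by fun_prop)
  have hJ0 := hD.tendstoInMeasure_average_weightedObs hu hc hmin hbar hconv 1 (hm.pow_const 2) hLsq
  have hJ1 := hD.tendstoInMeasure_average_weightedObs hu hc hmin hbar hconv 1 hm hL2
  have hJ2 := hD.tendstoInMeasure_average_weightedObs hu hc hmin hbar hconv 1
    (h := fun _ => 1) measurable_const (memLp_const 1)
  have h := tendstoInMeasure_mul_const hG (tendstoInMeasure_add_const hJ0
    (tendstoInMeasure_add_const (tendstoInMeasure_mul_const hθ1 hJ1)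
      (tendstoInMeasure_mul_const hθ2 hJ2)))
  rw [integral_armVarIntegrand hc hbar hL2, one_pow, inv_one, one_mul] at h
  refine h.congr_left fun n => Eventually.of_forall fun ω => ?_
  simp only
  rw [residualMean_eq_weightedAvg, weightMean_eq_weightedAvg]
  rfl

/-- The estimation error of an arm is asymptotically linear. -/
lemma tendstoInMeasure_armEstimator_sub (hD : IsBanditExperiment P ν π D)
    (hu : Unconfounded P D) (hc : 0 < c)
    (hmin : ∀ t, ∀ᵐ ω ∂P, c ≤ (π t).prob (D.histX t ω) a) (hbar : ∀ᵐ z ∂ν, c ≤ πbar.prob z.1 a)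
    (hconv : PolicyConverges P π D πbar)
    (hL : MemLp (fun z : 𝒳 × (Fin K → ℝ) => targetOutcome πe a (z.1, z.2 a)) 2 ν) :
    TendstoInMeasure P (fun (n : ℕ) ω => √(n : ℝ) * (armEstimator πe D n a ω - armTarget ν πe a) -
      (√(n : ℝ))⁻¹ * ∑ t ∈ Finset.range n,
        weightedObs D a 0 (fun q => targetOutcome πe a q - armTarget ν πe a) t ω) atTop
      fun _ => 0 := by
  have := hD.isProbabilityMeasure
  set θ := armTarget ν πe a with hθ
  have hG := hD.tendstoInMeasure_weightedAvg_one hu hc hmin hbar hconv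
  have hgm : Measurable fun q => targetOutcome πe a q - θ :=
    (measurable_targetOutcome πe a).sub_const θ
  have hgL : MemLp (fun z : 𝒳 × (Fin K → ℝ) => targetOutcome πe a (z.1, z.2 a) - θ) 2 ν :=
    hL.sub (memLp_const θ)
  have hg0 : ∫ z, (targetOutcome πe a (z.1, z.2 a) - θ) ∂ν = 0 := by
    rw [integral_sub (hL.integrable (by norm_num)) (integrable_const _)]
    simp [hθ, armTarget, targetOutcome]
  -- Replacing $\hat G^{-1}$ by $1$ costs a factor tending to $0$ times a normalized sum bounded in
  -- $L^2$.
  have h1 : TendstoInMeasure P (fun (n : ℕ) ω => ((weightedAvg D a 0 (fun _ => 1) n ω)⁻¹ - 1) *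
      ((√(n : ℝ))⁻¹ * ∑ t ∈ Finset.range n,
        weightedObs D a 0 (fun q => targetOutcome πe a q - θ) t ω)) atTop fun _ => 0 := by
    have hGc : ContinuousAt (fun x : ℝ => x⁻¹ - 1) 1 :=
      (continuousAt_inv₀ one_ne_zero).sub continuousAt_const
    have hG1 := tendstoInMeasure_comp_continuousAt hG hGc
    rw [inv_one, sub_self] at hG1
    exact tendstoInMeasure_mul_of_integral_sq_le hG1
      (fun n => ((memLp_finsetSum _ fun t _ =>
        hD.memLp_weightedObs hc hmin 0 hgm hgL t).const_mul _).integrable_sq)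
      (hD.integral_sq_inv_sqrt_mul_sum_weightedObs_le hu hc hmin hgm hgL hg0)
  -- This correction is nonzero only where $\hat G=0$, because $0^{-1}=0$. There $\hat G$ is at
  -- distance $1$ from its limit, so the probability vanishes and the growth of $\sqrt n$ is
  -- harmless.
  have h2 : TendstoInMeasure P (fun (n : ℕ) ω => ((weightedAvg D a 0 (fun _ => 1) n ω)⁻¹ *
      weightedAvg D a 0 (fun _ => 1) n ω - 1) * (√(n : ℝ) * θ)) atTop fun _ => 0 := by
    rw [tendstoInMeasure_iff_dist] at hG ⊢
    intro ε hε
    refine tendsto_of_tendsto_of_tendsto_of_le_of_le tendsto_const_nhds (hG 1 one_pos)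
      (fun _ => zero_le) fun n => measure_mono fun ω hω => ?_
    have hω' : ε ≤ dist (((weightedAvg D a 0 (fun _ => 1) n ω)⁻¹ *
      weightedAvg D a 0 (fun _ => 1) n ω - 1) * (√(n : ℝ) * θ)) 0 := hω
    change 1 ≤ dist (weightedAvg D a 0 (fun _ => 1) n ω) 1
    by_cases h0 : weightedAvg D a 0 (fun _ => 1) n ω = 0
    · simp [h0]
    · rw [inv_mul_cancel₀ h0, sub_self, zero_mul, dist_self] at hω'
      exact absurd hω' (not_le.2 hε)
  have h := tendstoInMeasure_add_const h1 h2
  rw [add_zero] at h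
  refine h.congr_left fun n => Eventually.of_forall fun ω => ?_
  simp only
  rw [inv_sqrt_mul_sum_weightedObs_sub, armEstimator_eq_weightedAvg]
  ring

/-- Asymptotic normality of the value estimator. -/
lemma tendstoInDistribution_valueEstimator (hD : IsBanditExperiment P ν π D)
    (hu : Unconfounded P D) {c : Fin K → ℝ} (hc : ∀ a, 0 < c a)
    (hmin : ∀ a t, ∀ᵐ ω ∂P, c a ≤ (π t).prob (D.histX t ω) a)
    (hbar : ∀ a, ∀ᵐ z ∂ν, c a ≤ πbar.prob z.1 a)
    (hconv : PolicyConverges P π D πbar)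
    (hL : ∀ a, MemLp (fun z : 𝒳 × (Fin K → ℝ) => targetOutcome πe a (z.1, z.2 a)) 4 ν) :
    TendstoInDistribution (fun (n : ℕ) ω =>
        √(n : ℝ) * (valueEstimator πe D n ω - policyValue ν πe)) atTop id (fun _ => P)
      (gaussianReal 0 (asympVar ν πe πbar).toNNReal) := by
  have := hD.isProbabilityMeasure
  have hL2 := fun a => (hL a).mono_exponent (p := 2) (by norm_num)
  have hL1 := fun a => (hL a).integrable (by norm_num)
  have hV : policyValue ν πe = ∑ a, armTarget ν πe a :=
    integral_finsetSum _ fun a _ => hL1 a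
  have hclt := hD.tendstoInDistribution_sum_weightedObs hu hc hmin hbar hconv
    (h := fun a q => targetOutcome πe a q - armTarget ν πe a)
    (fun a => (measurable_targetOutcome πe a).sub_const _)
    (fun a => (hL a).sub (memLp_const _)) fun a => by
      rw [integral_sub (hL1 a) (integrable_const _)]
      simp [armTarget, targetOutcome]
  have hvar : ∑ a, weightedMean ν πbar a 1 (fun q => (targetOutcome πe a q - armTarget ν πe a) ^ 2)
      = asympVar ν πe πbar := by
    simp only [weightedMean, asympVar, armVarIntegrand, targetOutcome, pow_one, div_eq_mul_inv]
  rw [hvar] at hclt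
  -- Slutsky: summed over arms, the normalized error differs from the linear sum by a term tending
  -- to $0$ in measure.
  refine tendstoInDistribution_of_tendstoInMeasure_sub _ _ hclt ?_ fun n => ?_
  · have h := tendstoInMeasure_finsetSum_const Finset.univ fun a _ =>
      hD.tendstoInMeasure_armEstimator_sub hu (hc a) (hmin a) (hbar a) hconv (hL2 a)
    rw [Finset.sum_const_zero] at h
    refine h.congr_left fun n => Eventually.of_forall fun ω => ?_
    simp only [Pi.sub_apply, valueEstimator, hV]
    rw [Finset.sum_sub_distrib, ← Finset.mul_sum, ← Finset.mul_sum, Finset.sum_sub_distrib,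
      Finset.sum_comm]
  · exact (((Finset.measurable_fun_sum _ fun a _ =>
      hD.measurable_armEstimator n a).sub_const _).const_mul _).aemeasurable

end IsBanditExperiment

end OffPolicy

/-! ### The theorem. -/

theorem corollary3 {Ω 𝒳 : Type*} [MeasurableSpace Ω] [MeasurableSpace 𝒳] {K : ℕ}
    (P : Measure Ω) [IsProbabilityMeasure P]
    (ν : Measure (𝒳 × (Fin K → ℝ)))
    (π : OffPolicy.BehaviorPolicy 𝒳 K) (D : OffPolicy.BanditData Ω 𝒳 K)
    (πe πbar : OffPolicy.StochasticPolicy 𝒳 K)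
    (hD : OffPolicy.IsBanditExperiment P ν π D)
    (hunconf : OffPolicy.Unconfounded P D)
    (hY4 : ∀ t, Integrable (fun ω => D.Yobs t ω ^ 4) P)
    (hconv : OffPolicy.PolicyConverges P π D πbar)
    (hmin : ∀ a, OffPolicy.MinSampling P π D a) :
    -- the quantities below are well defined
    (∀ a, Integrable (fun z => πe.prob z.1 a * z.2 a) ν) ∧
    (∀ a, ∀ᵐ z ∂ν, 0 < πbar.prob z.1 a) ∧
    (∀ a, Integrable (OffPolicy.armVarIntegrand ν πe πbar a) ν) ∧
    -- asymptotic normality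
    TendstoInDistribution
      (fun (T : ℕ) ω =>
        √(T : ℝ) * (OffPolicy.valueEstimator πe D T ω - OffPolicy.policyValue ν πe))
      atTop id (fun _ => P)
      (gaussianReal 0 (OffPolicy.asympVar ν πe πbar).toNNReal) ∧
    -- consistency of the variance estimator
    TendstoInMeasure P (OffPolicy.varEstimator πe D) atTop
      (fun _ => OffPolicy.asympVar ν πe πbar) := by
  choose c hc hmin' using hmin
  have := hD.isProbabilityMeasure
  have hc0 : ∀ a, 0 < c a := fun a => (hc a).1
  -- The limit policy keeps the lower bound of each arm, which gives its positivity and a bounded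
  -- inverse, hence a finite variance.
  have hbar := fun a => hD.ae_le_limit_prob hconv (hmin' a)
  have hL := fun a => OffPolicy.memLp_targetOutcome (πe := πe)
    (hD.integrable_pow_four hunconf (hY4 0) (hc0 a) (hmin' a 0))
  have hL1 := fun a => (hL a).integrable (by norm_num)
  refine ⟨hL1, fun a => (hbar a).mono fun z hz => (hc0 a).trans_le hz, fun a => ?_,
    hD.tendstoInDistribution_valueEstimator hunconf hc0 hmin' hbar hconv hL, ?_⟩
  · have hg := ((hL a).mono_exponent (p := 2) (by norm_num)).sub
      (memLp_const (OffPolicy.armTarget ν πe a))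
    refine (OffPolicy.integrable_mul_inv_prob (hc0 a) (hbar a)
      hg.integrable_sq).congr (Eventually.of_forall fun z => ?_)
    simp [OffPolicy.armVarIntegrand, OffPolicy.targetOutcome, div_eq_mul_inv]
  · exact tendstoInMeasure_finsetSum_const Finset.univ fun a _ =>
      hD.tendstoInMeasure_armVarEstimator hunconf (hc0 a) (hmin' a) (hbar a) hconv (hL a)
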